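/- Let $F$ be a field of characteristic $2$. For $g\in F[[x_1,\dots,x_r]]$ and $q=2^n$ let $e_n(g)=\dim_F F[[x_1,\dots,x_r]]/(x_1^q,\dots,x_r^q,g)$; for $g\neq 0$ in the maximal ideal, the Hilbert–Kunz multiplicity of the hypersurface $g=0$ is $\lim_{n\to\infty} e_n(g)/q^{\,r-1}$. Let $I=[0,1]\cap\mathbb Z[\tfrac12]$ and let $\phi_g:I\to\mathbb Q$ be the function with $\phi_g(i/q)=q^{-r}e_n(g^i)$ for all $q=2^n$ and $0\le i\le q$. Let $\phi_0,\phi_1,\phi_2,\dots:I\to\mathbb Q$ be the unique functions with $\phi_k(0)=\phi_k(1)=0$ for all $k$ such that, for all $t\in I$, - $8\phi_k(t/2)=\phi_{k+1}(t)+(4k+3)t$ if $k$ is even, - $8\phi_0((1+t)/2)=\phi_0(t)+3(1-t)$, - $8\phi_k((1+t)/2)=\phi_{k-1}(t)+(4k+3)(1-t)+t(1-t)$ if $k>0$ is even, - $8\phi_k(t/2)=\phi_{k-1}(t)+(4k+3)t+t(1-t)$ if $k$ is odd, - $8\phi_k((1+t)/2)=\phi_{k+1}(t)+(4k+3)(1-t)$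 if $k$ is odd. **Theorem.** Let $f=x^3+y^3+xyz\in F[[x,y,z]]$ and suppose that the conjecture $\phi_f=t+\phi_0$ holds, i.e. $\phi_f(t)=t+\phi_0(t)$ for all $t\in I$. Then the value $\sum_{n\ge 0}\binom{2n}{n}^2\lambda^{2n}$ at $\lambda=2^{-8}$ (the series converges) is a $\mathbb Q$-linear combination of Hilbert–Kunz multiplicities of hypersurfaces $g=0$ over $F$, where $0\ne g$ lies in the maximal ideal of some $F[[x_1,\dots,x_r]]$. -/

import Mathlib

open Filter Topology

noncomputable section

namespace HilbertKunz

/-- The `n`-th Hilbert-Kunz value in characteristic 2: with `q = 2 ^ n`, `e_n(g)` is the colength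
(the dimension over `F`) of the ideal `(x_1^q, …, x_r^q, g)` of `F[[x_1, …, x_r]]`. This dimension
is finite, since it is at most `q ^ r`. -/
def hk {F : Type*} [Field F] {r : ℕ} (n : ℕ) (g : MvPowerSeries (Fin r) F) : ℕ :=
  Module.finrank F (MvPowerSeries (Fin r) F ⧸
    Ideal.span (Set.range (fun j : Fin r => (MvPowerSeries.X j : MvPowerSeries (Fin r) F) ^ 2 ^ n)
      ∪ {g}))

/-- `μ` is the Hilbert-Kunz multiplicity of the hypersurface `g = 0` in `r` variables, i.e.
`e_n(g) / q ^ (r - 1) → μ`, where `q = 2 ^ n`. -/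
def IsHKMultiplicity {F : Type*} [Field F] {r : ℕ} (g : MvPowerSeries (Fin r) F) (μ : ℝ) : Prop :=
  Tendsto (fun n : ℕ => (hk n g : ℝ) / ((2 : ℝ) ^ n) ^ (r - 1)) atTop (𝓝 μ)

/-- The Hilbert-Kunz multiplicities of hypersurfaces over `F`: those of the nonzero elements `g` of
the maximal ideal of `F[[x_1, …, x_r]]`, for all `r`. (No such `g` exists when `r = 0`.) -/
def hkMultiplicities (F : Type*) [Field F] : Set ℝ :=
  {μ | ∃ (r : ℕ) (g : MvPowerSeries (Fin r) F),
    g ≠ 0 ∧ MvPowerSeries.constantCoeff g = 0 ∧ IsHKMultiplicity g μ}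

/-- `I = [0,1] ∩ ℤ[1/2]`. -/
def I : Set ℚ := {t | 0 ≤ t ∧ t ≤ 1 ∧ ∃ n i : ℕ, t * 2 ^ n = i}

/-- The vector space of all functions `I → ℚ`. -/
abbrev X : Type := I → ℚ

/-- The point `i / 2 ^ n` of `I`. -/
def dyadic (n i : ℕ) (hi : i ≤ 2 ^ n) : I :=
  ⟨(i : ℚ) / 2 ^ n, by positivity,
    (div_le_one (by positivity)).2 (by exact_mod_cast hi), n, i, by field_simp⟩

/-- `IsPhi g α` says that `α` is the function `φ_g`, the element of `X` whose value at `i / q` is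
`q ^ (-r) * e_n(g ^ i)` for all `q = 2 ^ n` and all `0 ≤ i ≤ q`. -/
def IsPhi {F : Type*} [Field F] {r : ℕ} (g : MvPowerSeries (Fin r) F) (α : X) : Prop :=
  ∀ (n i : ℕ) (hi : i ≤ 2 ^ n), α (dyadic n i hi) = (hk n (g ^ i) : ℚ) / ((2 : ℚ) ^ n) ^ r

/-- `f = x^3 + y^3 + xyz`. -/
def nodalCubic (F : Type*) [Field F] : MvPowerSeries (Fin 3) F :=
  MvPowerSeries.X 0 ^ 3 + MvPowerSeries.X 1 ^ 3
    + MvPowerSeries.X 0 * MvPowerSeries.X 1 * MvPowerSeries.X 2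

/-- The recursion, on `n`, for the value of `φ_k` at a point `t = i / 2 ^ n` of `[0,1]`. It is the
system of equations `phi_zero`, `phi_one`, `phi_even_left`, …, `phi_odd_right` below, solved
for the value at `t`. -/
def phiAux : ℕ → ℕ → ℚ → ℚ
  | 0, _, _ => 0
  | n + 1, k, t =>
    if Even k then
      if 2 * t ≤ 1 then
        (phiAux n (k + 1) (2 * t) + (4 * k + 3) * (2 * t)) / 8
      else if k = 0 then
        (phiAux n 0 (2 * t - 1) + 3 * (1 - (2 * t - 1))) / 8
      else
        (phiAux n (k - 1) (2 * t - 1) + (4 * k + 3) * (1 - (2 * t - 1))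
          + (2 * t - 1) * (1 - (2 * t - 1))) / 8
    else
      if 2 * t ≤ 1 then
        (phiAux n (k - 1) (2 * t) + (4 * k + 3) * (2 * t) + 2 * t * (1 - 2 * t)) / 8
      else
        (phiAux n (k + 1) (2 * t - 1) + (4 * k + 3) * (1 - (2 * t - 1))) / 8

/-- The functions `φ_0, φ_1, φ_2, …` of `X`. They are the unique functions `I → ℚ` that vanish at
`0` and `1` and satisfy, for all `t` in `I`,
* `8 φ_k(t/2) = φ_{k+1}(t) + (4k+3) t` if `k` is even,
* `8 φ_0((1+t)/2) = φ_0(t) + 3 (1-t)`,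
* `8 φ_k((1+t)/2) = φ_{k-1}(t) + (4k+3) (1-t) + t (1-t)` if `k > 0` is even,
* `8 φ_k(t/2) = φ_{k-1}(t) + (4k+3) t + t (1-t)` if `k` is odd,
* `8 φ_k((1+t)/2) = φ_{k+1}(t) + (4k+3) (1-t)` if `k` is odd;
see `phi_zero`, …, `phi_odd_right` and `phi_unique`. -/
def phi (k : ℕ) : X := fun t => phiAux t.2.2.2.choose k t

lemma phiAux_zero (n k : ℕ) : phiAux n k 0 = 0 := by
  induction n generalizing k with
  | zero => rfl
  | succ n ih => by_cases hk : Even k <;> simp [phiAux, hk, ih]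

lemma phiAux_one (n k : ℕ) : phiAux n k 1 = 0 := by
  induction n generalizing k with
  | zero => rfl
  | succ n ih =>
    have h2 : ¬ ((2 : ℚ) * 1 ≤ 1) := by norm_num
    have h3 : (2 : ℚ) * 1 - 1 = 1 := by norm_num
    simp only [phiAux, if_neg h2, h3, ih]
    split_ifs <;> norm_num

lemma phiAux_succ (n k : ℕ) (t : ℚ) (h0 : 0 ≤ t) (h1 : t ≤ 1) (h : ∃ i : ℕ, t * 2 ^ n = i) :
    phiAux (n + 1) k t = phiAux n k t := by
  induction n generalizing k t with
  | zero =>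
    obtain ⟨i, hi⟩ := h
    have hi' : t = i := by simpa using hi
    have : i ≤ 1 := by rw [hi'] at h1; exact_mod_cast h1
    interval_cases i
    · simp only [hi', Nat.cast_zero, phiAux_zero]
    · simp only [hi', Nat.cast_one, phiAux_one]
  | succ n ih =>
    obtain ⟨i, hi⟩ := h
    rw [phiAux.eq_2 k t (n + 1), phiAux.eq_2 k t n]
    by_cases ht : 2 * t ≤ 1
    · have h2 : ∀ k, phiAux (n + 1) k (2 * t) = phiAux n k (2 * t) := fun k =>
        ih k _ (by linarith) ht ⟨i, by rw [← hi]; ring⟩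
      simp only [if_pos ht, h2]
    · have hle : 2 ^ n ≤ i := by
        have : (2 : ℚ) ^ n ≤ i := by
          rw [← hi, pow_succ]
          have : (0 : ℚ) < 2 ^ n := by positivity
          nlinarith
        exact_mod_cast this
      have h2 : ∀ k, phiAux (n + 1) k (2 * t - 1) = phiAux n k (2 * t - 1) := fun k =>
        ih k _ (by linarith) (by linarith) ⟨i - 2 ^ n, by
          rw [Nat.cast_sub hle, ← hi]; push_cast; ring⟩
      simp only [if_neg ht, h2]

lemma phiAux_add (n m k : ℕ) (t : ℚ) (h0 : 0 ≤ t) (h1 : t ≤ 1) (h : ∃ i : ℕ, t * 2 ^ n = i) :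
    phiAux (n + m) k t = phiAux n k t := by
  induction m with
  | zero => rfl
  | succ m ih =>
    rw [← ih, ← add_assoc]
    obtain ⟨i, hi⟩ := h
    exact phiAux_succ _ k t h0 h1 ⟨i * 2 ^ m, by rw [pow_add, ← mul_assoc, hi]; push_cast; rfl⟩

/-- The value of `φ_k` at `t` does not depend on the way in which `t` is written as `i / 2 ^ n`. -/
lemma phi_eq_phiAux (k : ℕ) (t : I) (n : ℕ) (h : ∃ i : ℕ, (t : ℚ) * 2 ^ n = i) :
    phi k t = phiAux n k t := by
  have h' := t.2.2.2.choose_spec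
  rw [phi, ← phiAux_add _ n k t t.2.1 t.2.2.1 h', add_comm,
    phiAux_add _ _ k t t.2.1 t.2.2.1 h]

/-- The point `t / 2` of `I`. -/
def left (t : I) : I :=
  ⟨t / 2, by linarith [t.2.1], by linarith [t.2.1, t.2.2.1], by
    obtain ⟨n, i, h⟩ := t.2.2.2
    exact ⟨n + 1, i, by rw [← h]; ring⟩⟩

/-- The point `(1 + t) / 2` of `I`. -/
def right (t : I) : I :=
  ⟨(1 + t) / 2, by linarith [t.2.1], by linarith [t.2.1, t.2.2.1], by
    obtain ⟨n, i, h⟩ := t.2.2.2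
    exact ⟨n + 1, i + 2 ^ n, by push_cast; rw [← h]; ring⟩⟩

lemma phi_zero (k : ℕ) (t : I) (ht : (t : ℚ) = 0) : phi k t = 0 := by
  unfold phi
  generalize Exists.choose _ = m
  rw [ht, phiAux_zero]

lemma phi_one (k : ℕ) (t : I) (ht : (t : ℚ) = 1) : phi k t = 0 := by
  unfold phi
  generalize Exists.choose _ = m
  rw [ht, phiAux_one]

lemma phi_left (k : ℕ) (t : I) :
    8 * phi k (left t) = if Even k then phi (k + 1) t + (4 * k + 3) * t
      else phi (k - 1) t + (4 * k + 3) * t + t * (1 - t) := by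
  obtain ⟨n, i, h⟩ := t.2.2.2
  have e : 2 * ((t : ℚ) / 2) = t := by ring
  rw [phi_eq_phiAux k (left t) (n + 1) ⟨i, by rw [← h, left]; ring⟩,
    phi_eq_phiAux _ t n ⟨i, h⟩, phi_eq_phiAux _ t n ⟨i, h⟩, phiAux]
  simp only [left, e, if_pos t.2.2.1]
  split_ifs <;> ring

lemma phi_right (k : ℕ) (t : I) :
    8 * phi k (right t) = if Even k then
        (if k = 0 then phi 0 t + 3 * (1 - t)
          else phi (k - 1) t + (4 * k + 3) * (1 - t) + t * (1 - t))
      else phi (k + 1) t + (4 * k + 3) * (1 - t) := by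
  rcases eq_or_lt_of_le t.2.1 with h0 | h0
  · have e : right t = left (dyadic 0 1 (by norm_num)) := by
      apply Subtype.ext; simp [right, left, dyadic, ← h0]
    have hd : ((dyadic 0 1 (by norm_num) : I) : ℚ) = 1 := by simp [dyadic]
    have hz : ∀ j, phi j t = 0 := fun j => phi_zero j t h0.symm
    have ho : ∀ j, phi j (dyadic 0 1 (by norm_num)) = 0 := fun j => phi_one j _ hd
    rw [e, phi_left]
    simp only [hz, ho, hd, ← h0]
    split_ifs with h1 h2
    · simp [h2]
    · ring
    · ring
  · obtain ⟨n, i, h⟩ := t.2.2.2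
    have e : 2 * ((1 + (t : ℚ)) / 2) - 1 = t := by ring
    have hn : ¬ (2 * ((1 + (t : ℚ)) / 2) ≤ 1) := by linarith
    rw [phi_eq_phiAux k (right t) (n + 1) ⟨i + 2 ^ n, by push_cast; rw [← h, right]; ring⟩,
      phi_eq_phiAux _ t n ⟨i, h⟩, phi_eq_phiAux _ t n ⟨i, h⟩, phi_eq_phiAux _ t n ⟨i, h⟩, phiAux]
    simp only [right, e, if_neg hn]
    split_ifs <;> ring

lemma phi_even_left (k : ℕ) (hk : Even k) (t : I) :
    8 * phi k (left t) = phi (k + 1) t + (4 * k + 3) * t := by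
  rw [phi_left, if_pos hk]

lemma phi_zero_right (t : I) : 8 * phi 0 (right t) = phi 0 t + 3 * (1 - t) := by
  rw [phi_right, if_pos (by decide), if_pos rfl]

lemma phi_even_right (k : ℕ) (hk : Even k) (h0 : 0 < k) (t : I) :
    8 * phi k (right t) = phi (k - 1) t + (4 * k + 3) * (1 - t) + t * (1 - t) := by
  rw [phi_right, if_pos hk, if_neg h0.ne']

lemma phi_odd_left (k : ℕ) (hk : Odd k) (t : I) :
    8 * phi k (left t) = phi (k - 1) t + (4 * k + 3) * t + t * (1 - t) := by
  rw [phi_left, if_neg (Nat.not_even_iff_odd.2 hk)]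

lemma phi_odd_right (k : ℕ) (hk : Odd k) (t : I) :
    8 * phi k (right t) = phi (k + 1) t + (4 * k + 3) * (1 - t) := by
  rw [phi_right, if_neg (Nat.not_even_iff_odd.2 hk)]

/-- The equations above determine all the functions `φ_k`. -/
lemma phi_unique (ψ : ℕ → X) (h0 : ∀ k (t : I), (t : ℚ) = 0 → ψ k t = 0)
    (h1 : ∀ k (t : I), (t : ℚ) = 1 → ψ k t = 0)
    (hel : ∀ k, Even k → ∀ t, 8 * ψ k (left t) = ψ (k + 1) t + (4 * k + 3) * t)
    (hzr : ∀ t, 8 * ψ 0 (right t) = ψ 0 t + 3 * (1 - t))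
    (her : ∀ k, Even k → 0 < k → ∀ t,
      8 * ψ k (right t) = ψ (k - 1) t + (4 * k + 3) * (1 - t) + t * (1 - t))
    (hol : ∀ k, Odd k → ∀ t,
      8 * ψ k (left t) = ψ (k - 1) t + (4 * k + 3) * t + t * (1 - t))
    (hor : ∀ k, Odd k → ∀ t, 8 * ψ k (right t) = ψ (k + 1) t + (4 * k + 3) * (1 - t)) :
    ψ = phi := by
  suffices H : ∀ (n k : ℕ) (t : I), (∃ i : ℕ, (t : ℚ) * 2 ^ n = i) → ψ k t = phi k t by
    funext k t
    obtain ⟨n, h⟩ := t.2.2.2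
    exact H n k t h
  intro n
  induction n with
  | zero =>
    rintro k t ⟨i, hi⟩
    have hi' : (t : ℚ) = i := by simpa using hi
    have : i ≤ 1 := by have := t.2.2.1; rw [hi'] at this; exact_mod_cast this
    interval_cases i
    · rw [h0 k t (by simpa using hi'), phi_zero k t (by simpa using hi')]
    · rw [h1 k t (by simpa using hi'), phi_one k t (by simpa using hi')]
  | succ n ih =>
    rintro k t ⟨i, hi⟩
    by_cases ht : 2 * (t : ℚ) ≤ 1
    · have hs : ∃ j : ℕ, (2 * (t : ℚ)) * 2 ^ n = j := ⟨i, by rw [← hi]; ring⟩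
      obtain ⟨s, hs'⟩ : ∃ s : I, (s : ℚ) = 2 * t :=
        ⟨⟨2 * t, by linarith [t.2.1], ht, n, hs⟩, rfl⟩
      have e : t = left s := by apply Subtype.ext; simp [left, hs']
      rw [← hs'] at hs
      rcases Nat.even_or_odd k with hk | hk
      · have a := hel k hk s
        have b := phi_even_left k hk s
        rw [ih _ s hs] at a
        rw [e]; linarith
      · have a := hol k hk s
        have b := phi_odd_left k hk s
        rw [ih _ s hs] at a
        rw [e]; linarith
    · have hle : 2 ^ n ≤ i := by
        have : (2 : ℚ) ^ n ≤ i := by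
          rw [← hi, pow_succ]
          have : (0 : ℚ) < 2 ^ n := by positivity
          nlinarith
        exact_mod_cast this
      have hs : ∃ j : ℕ, (2 * (t : ℚ) - 1) * 2 ^ n = j :=
        ⟨i - 2 ^ n, by rw [Nat.cast_sub hle, ← hi]; push_cast; ring⟩
      obtain ⟨s, hs'⟩ : ∃ s : I, (s : ℚ) = 2 * t - 1 :=
        ⟨⟨2 * t - 1, by linarith, by linarith [t.2.2.1], n, hs⟩, rfl⟩
      have e : t = right s := by apply Subtype.ext; simp [right, hs']
      rw [← hs'] at hs
      rcases Nat.even_or_odd k with hk | hk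
      · rcases Nat.eq_zero_or_pos k with rfl | hp
        · have a := hzr s
          have b := phi_zero_right s
          rw [ih _ s hs] at a
          rw [e]; linarith
        · have a := her k hk hp s
          have b := phi_even_right k hk hp s
          rw [ih _ s hs] at a
          rw [e]; linarith
      · have a := hor k hk s
        have b := phi_odd_right k hk s
        rw [ih _ s hs] at a
        rw [e]; linarith

/-- The conjecture `φ_f = t + φ_0` for `f = x^3 + y^3 + xyz` over `F`. -/
def NodalCubicConjecture (F : Type*) [Field F] : Prop :=
  IsPhi (nodalCubic F) (fun t => (t : ℚ) + phi 0 t)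

end HilbertKunz

end

open Filter Topology

noncomputable section

namespace HilbertKunz

universe u

/-! ### Addition without carries -/

/-! The basic invariant of a nilpotent `T` in a finite-dimensional algebra `A` is `jump F T c`, the
dimension of `T^c A / T^(c+1) A`. In the polynomial ring truncated at `q`-th powers, `e_n(p)` is the
jump of `p` at `0`, and the jumps of `f` are the increments of `q^3 φ_f` (`sum_jump_eq_hk`). In
characteristic 2 the jumps of `p(x) + p'(y)` are the convolution of those of `p` and `p'` for
exclusive or (`jump_add`); this rests on an ideal membership proved by Frobenius, one binary digit
at a time (`pow_mul_add_pow_mem`).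

The characters of exclusive or turn this convolution into products. The jumps of `uv` involve only
the constant and the one-digit (Rademacher) characters, so in `f(x)^(2^i) + f(x')^(2^j) + uv + u'v'`
only these survive. By `hk_hyper_div` its multiplicity is `1 + ∑ 4^(-m-1) a_i(m) a_j(m)`, where `a_j
= powCoeff j` is the Rademacher sequence of `φ_0` delayed by `j` places and preceded by ones.

The functional equations of the `φ_k` become a recursion for Rademacher coefficients: a walk on the
natural numbers with a loop at `0`, plus a forcing term. A fixed combination of three consecutive
coefficients cancels all but walk counts (`phiCoeff_combination`), leaving `8^(-m) d_m / 2` with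
`d_m = w_(m+1) - 6 w_m`, where `w_m` is a central binomial coefficient for even `m` and half of one
for odd `m`.

Taking this combination in both factors puts `∑ 256^(-m) d_m^2` and `∑ 256^(-m) d_m d_(m+1)` in the
span. Split by parity of `m`, both are rational combinations of `1`, the wanted series `P`, and the
series `R` of products of consecutive central binomial coefficients. The two relations are
independent, so `R` can be eliminated (`tsum_mem_span`). -/

theorem two_pow_add_eq_xor {n i : ℕ} (hi : i < 2 ^ n) : 2 ^ n + i = 2 ^ n ^^^ i := by
  have h := Nat.two_pow_add_eq_or_of_lt hi 1
  rw [mul_one] at h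
  rw [h]
  apply Nat.eq_of_testBit_eq
  intro k
  rw [Nat.testBit_or, Nat.testBit_xor, Nat.testBit_two_pow]
  by_cases h : n = k
  · subst h
    simp [Nat.testBit_lt_two_pow hi]
  · simp [h]

theorem two_pow_add_xor {n i c : ℕ} (hi : i < 2 ^ n) (hc : c < 2 ^ n) :
    (2 ^ n + i) ^^^ c = 2 ^ n + (i ^^^ c) := by
  rw [two_pow_add_eq_xor hi, two_pow_add_eq_xor (Nat.xor_lt_two_pow hi hc), Nat.xor_assoc]

theorem xor_two_pow_add {n i c : ℕ} (hi : i < 2 ^ n) (hc : c < 2 ^ n) :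
    i ^^^ (2 ^ n + c) = 2 ^ n + (i ^^^ c) := by
  rw [Nat.xor_comm, two_pow_add_xor hc hi, Nat.xor_comm]

theorem two_pow_add_xor_two_pow_add {n i c : ℕ} (hi : i < 2 ^ n) (hc : c < 2 ^ n) :
    (2 ^ n + i) ^^^ (2 ^ n + c) = i ^^^ c := by
  rw [two_pow_add_eq_xor hi, two_pow_add_eq_xor hc, Nat.xor_comm (2 ^ n) i, Nat.xor_assoc,
    ← Nat.xor_assoc (2 ^ n), Nat.xor_self, Nat.zero_xor]

theorem sum_range_xor {M : Type*} [AddCommMonoid M] {n c : ℕ} (hc : c < 2 ^ n) (F : ℕ → M) :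
    ∑ i ∈ Finset.range (2 ^ n), F (i ^^^ c) = ∑ i ∈ Finset.range (2 ^ n), F i := by
  refine Finset.sum_nbij' (· ^^^ c) (· ^^^ c) ?_ ?_ ?_ ?_ ?_ <;>
    simp +contextual [Nat.xor_lt_two_pow, hc]

/-- The number of pairs `i < a`, `j < b` with `i ^^^ j = c`. -/
def xorCount (a b c : ℕ) : ℕ := ((Finset.range a).filter (fun i => i ^^^ c < b)).card

/-- Exclusive or with a fixed `i` permutes the range, so each `i < a` contributes `b`. The total is
the dimension of `F[s,t]/(s^a, t^b)`, which later forces upper bounds on jumps to be equalities. -/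
theorem sum_xorCount {n a b : ℕ} (ha : a ≤ 2 ^ n) (hb : b ≤ 2 ^ n) :
    ∑ c ∈ Finset.range (2 ^ n), xorCount a b c = a * b := by
  simp only [xorCount, Finset.card_filter]
  rw [Finset.sum_comm]
  have : ∀ i ∈ Finset.range a,
      ∑ c ∈ Finset.range (2 ^ n), (if i ^^^ c < b then 1 else 0) = b := by
    intro i hi
    have h := sum_range_xor (n := n) (c := i) (by simp at hi; omega) (fun j => if j < b then 1 else 0)
    simp only [Nat.xor_comm _ i] at h
    rw [h, ← Finset.card_filter]
    have : (Finset.range (2 ^ n)).filter (· < b) = Finset.range b := by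
      ext x; simp; omega
    rw [this, Finset.card_range]
  rw [Finset.sum_congr rfl this]
  simp

/-- Lower bounds for `xorCount` suffice below, since it occurs as an exponent that may be raised
freely inside an ideal. -/
theorem le_xorCount_of_injOn {a b c m : ℕ} (S : Finset ℕ) (hS : m ≤ S.card) (g : ℕ → ℕ)
    (hg : Set.InjOn g S) (h : ∀ i ∈ S, g i < a ∧ g i ^^^ c < b) : m ≤ xorCount a b c := by
  refine hS.trans (Finset.card_le_card_of_injOn g (fun i hi => ?_) hg)
  simpa using h i hi

/-! ### Powers of `s + t` modulo `s^a` and `t^b` in characteristic 2 -/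

section Membership

variable {R : Type*} [CommRing R] [CharP R 2]

/-- Bounds the jump at `c` of `s + t` on a tensor product of Jordan blocks of sizes `a` and `b`.
With `T = s + t` and `Q = 2^n`, the induction removes the leading binary digit by means of `T^Q =
s^Q + t^Q`. -/
theorem pow_mul_add_pow_mem (s t : R) (n : ℕ) : ∀ a b c : ℕ, a ≤ 2 ^ n → b ≤ 2 ^ n → c < 2 ^ n →
    s ^ xorCount a b c * (s + t) ^ c ∈ Ideal.span {(s + t) ^ (c + 1), s ^ a, t ^ b} := by
  have two : (2 : R) = 0 := CharP.cast_eq_zero R 2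
  have up : ∀ (J : Ideal R) (m k : ℕ) (x : R), m ≤ k → s ^ m * x ∈ J → s ^ k * x ∈ J := by
    intro J m k x hmk hx
    have : s ^ k * x = s ^ (k - m) * (s ^ m * x) := by
      rw [← mul_assoc, ← pow_add, Nat.sub_add_cancel hmk]
    rw [this]
    exact J.mul_mem_left _ hx
  have mT : ∀ a b c, (s + t) ^ (c + 1) ∈ Ideal.span {(s + t) ^ (c + 1), s ^ a, t ^ b} :=
    fun a b c => Ideal.subset_span (by simp)
  have ms : ∀ a b c, s ^ a ∈ Ideal.span {(s + t) ^ (c + 1), s ^ a, t ^ b} :=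
    fun a b c => Ideal.subset_span (by simp)
  have mt : ∀ a b c, t ^ b ∈ Ideal.span {(s + t) ^ (c + 1), s ^ a, t ^ b} :=
    fun a b c => Ideal.subset_span (by simp)
  -- modulo `(s + t) ^ (c + 1)`, `s` and `t` act in the same way on `(s + t) ^ c`
  have swap : ∀ a b c k l : ℕ,
      s ^ k * t ^ l * (s + t) ^ c ∈ Ideal.span {(s + t) ^ (c + 1), s ^ a, t ^ b} →
      s ^ (k + l) * (s + t) ^ c ∈ Ideal.span {(s + t) ^ (c + 1), s ^ a, t ^ b} := by
    intro a b c k l h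
    obtain ⟨d, hd⟩ := sub_dvd_pow_sub_pow s t l
    have hst : s - t = s + t := by linear_combination (-t) * two
    have : s ^ (k + l) * (s + t) ^ c
        = s ^ k * t ^ l * (s + t) ^ c + s ^ k * d * (s + t) ^ (c + 1) := by
      rw [hst] at hd
      rw [pow_add, pow_succ]
      linear_combination (s ^ k * (s + t) ^ c) * hd
    rw [this]
    exact Ideal.add_mem _ h (Ideal.mul_mem_left _ _ (mT a b c))
  induction n with
  | zero =>
    intro a b c ha hb hc
    obtain rfl : c = 0 := by simpa using hc
    rcases Nat.eq_zero_or_pos a with rfl | ha'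
    · rw [Ideal.eq_top_of_isUnit_mem _ (ms 0 b 0) (by simp)]
      trivial
    rcases Nat.eq_zero_or_pos b with rfl | hb'
    · rw [Ideal.eq_top_of_isUnit_mem _ (mt a 0 0) (by simp)]
      trivial
    obtain rfl : a = 1 := by simp at ha; omega
    refine up _ 1 _ _ ?_ (Ideal.mul_mem_right _ _ (by simpa using ms 1 b 0))
    exact le_xorCount_of_injOn {0} (by simp) id Function.injective_id.injOn (by simpa using hb')
  | succ n ih =>
    intro a b c ha hb hc
    have frob : (s + t) ^ 2 ^ n = s ^ 2 ^ n + t ^ 2 ^ n := add_pow_char_pow s t 2 n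
    have hpow : 2 ^ (n + 1) = 2 ^ n + 2 ^ n := by ring
    rcases lt_or_ge c (2 ^ n) with hcQ | hcQ
    · rcases le_total a (2 ^ n) with haQ | haQ
      · rcases le_total b (2 ^ n) with hbQ | hbQ
        · exact ih a b c haQ hbQ hcQ
        · refine up _ a _ _ ?_ (Ideal.mul_mem_right _ _ (ms a b c))
          refine le_xorCount_of_injOn (Finset.range a) (by simp) id Function.injective_id.injOn ?_
          intro i hi
          rw [Finset.mem_range] at hi
          exact ⟨hi, (Nat.xor_lt_two_pow (by simp; omega) hcQ).trans_le hbQ⟩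
      · rcases le_total b (2 ^ n) with hbQ | hbQ
        · refine up _ b _ _ ?_ ?_
          · refine le_xorCount_of_injOn (Finset.range b) (by simp) (· ^^^ c) ?_ ?_
            · intro x _ y _ hxy
              simpa using congrArg (· ^^^ c) hxy
            · intro i hi
              rw [Finset.mem_range] at hi
              exact ⟨(Nat.xor_lt_two_pow (by omega) hcQ).trans_le haQ,
                by simpa [Nat.xor_assoc] using hi⟩
          · have := swap a b c 0 b
              (Ideal.mul_mem_right _ _ (Ideal.mul_mem_left _ _ (mt a b c)))
            simpa using this
        · obtain ⟨a', rfl⟩ := Nat.exists_eq_add_of_le haQ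
          obtain ⟨b', rfl⟩ := Nat.exists_eq_add_of_le hbQ
          -- The inductive relation is multiplied by `s^Q`. The term `s^Q t^b'` equals `T^Q t^b' -
          -- t^(Q+b')`, and `T^(c+1)` divides `T^Q` because `c < Q`.
          refine up _ (2 ^ n + xorCount a' b' c) _ _ ?_ ?_
          · have hd : Disjoint (Finset.range (2 ^ n))
                (((Finset.range a').filter (fun i => i ^^^ c < b')).map
                  (addLeftEmbedding (2 ^ n))) := by
              rw [Finset.disjoint_left]
              intro x hx hx'
              simp at hx hx'
              obtain ⟨y, _, hy⟩ := hx'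
              omega
            refine le_xorCount_of_injOn (Finset.disjUnion _ _ hd) ?_ id
              Function.injective_id.injOn ?_
            · rw [Finset.card_disjUnion, Finset.card_map, Finset.card_range, xorCount]
            · intro i hi
              simp only [Finset.mem_disjUnion, Finset.mem_range, Finset.mem_map,
                Finset.mem_filter, addLeftEmbedding_apply] at hi
              rcases hi with hi | ⟨i', ⟨h1, h2⟩, rfl⟩
              · have := Nat.xor_lt_two_pow hi hcQ
                simp only [id]
                omega
              · simp only [id]
                rw [two_pow_add_xor (by omega) hcQ]
                omega
          · have h := ih a' b' c (by omega) (by omega) hcQ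
            rw [Ideal.mem_span_insert] at h
            obtain ⟨x, z, hz, hxz⟩ := h
            rw [Ideal.mem_span_pair] at hz
            obtain ⟨y, w, rfl⟩ := hz
            obtain ⟨e, he⟩ := pow_dvd_pow (s + t) (Nat.succ_le_of_lt hcQ)
            have : s ^ (2 ^ n + xorCount a' b' c) * (s + t) ^ c
                = (s ^ 2 ^ n * x + w * t ^ b' * e) * (s + t) ^ (c + 1) + y * s ^ (2 ^ n + a')
                  + (- w) * t ^ (2 ^ n + b') := by
              rw [Nat.succ_eq_add_one, frob] at he
              simp only [pow_add _ (2 ^ n)]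
              linear_combination s ^ 2 ^ n * hxz + w * t ^ b' * he
            rw [this]
            exact Ideal.add_mem _ (Ideal.add_mem _ (Ideal.mul_mem_left _ _ (mT _ _ _))
              (Ideal.mul_mem_left _ _ (ms _ _ _))) (Ideal.mul_mem_left _ _ (mt _ _ _))
    · obtain ⟨c', rfl⟩ := Nat.exists_eq_add_of_le hcQ
      have hc' : c' < 2 ^ n := by omega
      rcases le_total a (2 ^ n) with haQ | haQ
      · rcases le_total b (2 ^ n) with hbQ | hbQ
        · refine Ideal.mul_mem_left _ _ ?_
          rw [pow_add (s + t) (2 ^ n) c', frob]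
          refine Ideal.mul_mem_right _ _ (Ideal.add_mem _ ?_ ?_)
          · exact Ideal.mem_of_dvd _ (pow_dvd_pow s haQ) (ms _ _ _)
          · exact Ideal.mem_of_dvd _ (pow_dvd_pow t hbQ) (mt _ _ _)
        · obtain ⟨b', rfl⟩ := Nat.exists_eq_add_of_le hbQ
          -- Here the inductive relation is multiplied by `T^Q = s^Q + t^Q`; the stray term
          -- containing `s^Q` is absorbed by `s^a` since `a ≤ Q`.
          refine up _ (xorCount a b' c') _ _ ?_ ?_
          · refine le_xorCount_of_injOn _ le_rfl id Function.injective_id.injOn ?_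
            intro i hi
            simp only [Finset.mem_filter, Finset.mem_range, id] at hi ⊢
            rw [xor_two_pow_add (by omega) hc']
            omega
          · have h := ih a b' c' haQ (by omega) hc'
            rw [Ideal.mem_span_insert] at h
            obtain ⟨x, z, hz, hxz⟩ := h
            rw [Ideal.mem_span_pair] at hz
            obtain ⟨y, w, rfl⟩ := hz
            obtain ⟨e, he⟩ := pow_dvd_pow s haQ
            have : s ^ xorCount a b' c' * (s + t) ^ (2 ^ n + c')
                = x * (s + t) ^ (2 ^ n + c' + 1)
                  + (y * (s ^ 2 ^ n + t ^ 2 ^ n) + w * t ^ b' * e) * s ^ a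
                  + w * t ^ (2 ^ n + b') := by
              simp only [pow_add _ (2 ^ n), add_assoc (2 ^ n), frob]
              linear_combination (s ^ 2 ^ n + t ^ 2 ^ n) * hxz + w * t ^ b' * he
            rw [this]
            exact Ideal.add_mem _ (Ideal.add_mem _ (Ideal.mul_mem_left _ _ (mT _ _ _))
              (Ideal.mul_mem_left _ _ (ms _ _ _))) (Ideal.mul_mem_left _ _ (mt _ _ _))
      · obtain ⟨a', rfl⟩ := Nat.exists_eq_add_of_le haQ
        rcases le_total b (2 ^ n) with hbQ | hbQ
        · refine up _ (xorCount a' b c') _ _ ?_ ?_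
          · refine le_xorCount_of_injOn _ le_rfl (2 ^ n + ·) (add_right_injective _).injOn ?_
            intro i hi
            simp only [Finset.mem_filter, Finset.mem_range] at hi ⊢
            rw [two_pow_add_xor_two_pow_add (by omega) hc']
            omega
          · have h := ih a' b c' (by omega) hbQ hc'
            rw [Ideal.mem_span_insert] at h
            obtain ⟨x, z, hz, hxz⟩ := h
            rw [Ideal.mem_span_pair] at hz
            obtain ⟨y, w, rfl⟩ := hz
            obtain ⟨e, he⟩ := pow_dvd_pow t hbQ
            have : s ^ xorCount a' b c' * (s + t) ^ (2 ^ n + c')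
                = x * (s + t) ^ (2 ^ n + c' + 1) + y * s ^ (2 ^ n + a')
                  + (w * (s ^ 2 ^ n + t ^ 2 ^ n) + y * s ^ a' * e) * t ^ b := by
              simp only [pow_add _ (2 ^ n), add_assoc (2 ^ n), frob]
              linear_combination (s ^ 2 ^ n + t ^ 2 ^ n) * hxz + y * s ^ a' * he
            rw [this]
            exact Ideal.add_mem _ (Ideal.add_mem _ (Ideal.mul_mem_left _ _ (mT _ _ _))
              (Ideal.mul_mem_left _ _ (ms _ _ _))) (Ideal.mul_mem_left _ _ (mt _ _ _))
        · obtain ⟨b', rfl⟩ := Nat.exists_eq_add_of_le hbQ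
          -- The indices `Q + i` with `i < a'` and the indices `j ^^^ c'` with `j < b'` are `a' +
          -- b'` distinct ones to count. The membership itself is direct: `s^a' t^b' T^Q` lies in
          -- `(s^a, t^b)`.
          refine up _ (a' + b') _ _ ?_ (swap _ _ _ _ _ ?_)
          · have hd : Disjoint ((Finset.range a').map (addLeftEmbedding (2 ^ n)))
                ((Finset.range b').image (· ^^^ c')) := by
              rw [Finset.disjoint_left]
              intro x hx hx'
              simp at hx hx'
              obtain ⟨y, _, rfl⟩ := hx
              obtain ⟨z, hz, hz'⟩ := hx'
              have := Nat.xor_lt_two_pow (n := n) (show z < 2 ^ n by omega) hc'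
              omega
            refine le_xorCount_of_injOn (Finset.disjUnion _ _ hd) ?_ id
              Function.injective_id.injOn ?_
            · rw [Finset.card_disjUnion, Finset.card_image_of_injective]
              · simp
              · intro x y hxy
                simpa using congrArg (· ^^^ c') hxy
            · intro i hi
              simp only [Finset.mem_disjUnion, Finset.mem_range, Finset.mem_map,
                Finset.mem_image, addLeftEmbedding_apply] at hi
              rcases hi with ⟨i', h1, rfl⟩ | ⟨j, hj, rfl⟩
              · simp only [id]
                have := Nat.xor_lt_two_pow (n := n) (show i' < 2 ^ n by omega) hc'
                rw [two_pow_add_xor_two_pow_add (by omega) hc']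
                omega
              · simp only [id]
                have := Nat.xor_lt_two_pow (n := n) (show j < 2 ^ n by omega) hc'
                rw [xor_two_pow_add this hc', Nat.xor_assoc, Nat.xor_self, Nat.xor_zero]
                omega
          · have : s ^ a' * t ^ b' * (s + t) ^ (2 ^ n + c')
                = (t ^ b' * (s + t) ^ c') * s ^ (2 ^ n + a')
                  + (s ^ a' * (s + t) ^ c') * t ^ (2 ^ n + b') := by
              simp only [pow_add _ (2 ^ n), frob]
              ring
            rw [this]
            exact Ideal.add_mem _ (Ideal.mul_mem_left _ _ (ms _ _ _))
              (Ideal.mul_mem_left _ _ (mt _ _ _))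

end Membership

/-! ### Rank jumps of the powers of a nilpotent element -/

section Jump

variable {F A : Type*} [Field F] [CommRing A] [Algebra F A]

/-- The principal ideal generated by `T ^ c`, as a vector space. -/
def powRange (F : Type*) {A : Type*} [Field F] [CommRing A] [Algebra F A] (T : A) (c : ℕ) :
    Submodule F A := LinearMap.range (LinearMap.mulLeft F (T ^ c))

/-- The number of Jordan blocks of size greater than `c` of multiplication by `T`. -/
def jump (F : Type*) {A : Type*} [Field F] [CommRing A] [Algebra F A] (T : A) (c : ℕ) : ℕ :=
  Module.finrank F (powRange F T c) - Module.finrank F (powRange F T (c + 1))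

theorem mem_powRange {T : A} {c : ℕ} {y : A} : y ∈ powRange F T c ↔ ∃ x, T ^ c * x = y := by
  simp [powRange]

theorem powRange_succ_le (T : A) (c : ℕ) : powRange F T (c + 1) ≤ powRange F T c := by
  intro y
  simp only [mem_powRange]
  rintro ⟨x, rfl⟩
  exact ⟨T * x, by ring⟩

theorem powRange_zero (T : A) : powRange F T 0 = ⊤ := by
  ext y
  simp [mem_powRange]

theorem powRange_eq_bot {T : A} {q : ℕ} (hT : T ^ q = 0) : powRange F T q = ⊥ := by
  ext y
  simp [mem_powRange, hT, eq_comm]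

variable [Module.Finite F A]

theorem jump_add_finrank (T : A) (c : ℕ) :
    jump F T c + Module.finrank F (powRange F T (c + 1)) = Module.finrank F (powRange F T c) :=
  Nat.sub_add_cancel (Submodule.finrank_mono (powRange_succ_le T c))

theorem sum_jump_add_finrank (T : A) (c : ℕ) :
    ∑ i ∈ Finset.range c, jump F T i + Module.finrank F (powRange F T c) = Module.finrank F A := by
  induction c with
  | zero => rw [powRange_zero, finrank_top, Finset.sum_range_zero, zero_add]
  | succ c ih => rw [Finset.sum_range_succ, add_assoc, jump_add_finrank, ih]

theorem sum_jump {T : A} {q : ℕ} (hT : T ^ q = 0) :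
    ∑ i ∈ Finset.range q, jump F T i = Module.finrank F A := by
  have := sum_jump_add_finrank (F := F) T q
  rwa [powRange_eq_bot hT, finrank_bot, add_zero] at this

/-- If the successive quotients of the filtration by powers of `T` have at most `d c` generators
and the `d c` add up to the dimension, then these quotients have dimension exactly `d c`. -/
theorem jump_eq_of_span {T : A} {q : ℕ} (hT : T ^ q = 0) (d : ℕ → ℕ)
    (hd : ∑ c ∈ Finset.range q, d c = Module.finrank F A)
    (h : ∀ c < q, ∃ S : Finset A, S.card ≤ d c ∧
      ∀ x, T ^ c * x ∈ Submodule.span F (S : Set A) ⊔ powRange F T (c + 1)) :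
    ∀ c < q, jump F T c = d c := by
  have hle : ∀ c ∈ Finset.range q, jump F T c ≤ d c := by
    intro c hc
    obtain ⟨S, hS, hx⟩ := h c (Finset.mem_range.1 hc)
    have h1 : powRange F T c ≤ Submodule.span F (S : Set A) ⊔ powRange F T (c + 1) := by
      intro y
      rw [mem_powRange]
      rintro ⟨x, rfl⟩
      exact hx x
    have h2 := Submodule.finrank_mono h1
    have h3 := Submodule.finrank_add_le_finrank_add_finrank (Submodule.span F (S : Set A))
      (powRange F T (c + 1))
    have h4 := finrank_span_finset_le_card (R := F) S
    have h5 := jump_add_finrank (F := F) T c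
    simp only [Set.finrank] at h4
    omega
  rw [← sum_jump hT (F := F)] at hd
  have := (Finset.sum_eq_sum_iff_of_le hle).1 hd.symm
  exact fun c hc => this c (Finset.mem_range.2 hc)

end Jump

/-- A nilpotent element has a Jordan basis, given by generators of its cyclic submodules. -/
theorem exists_jordan_generators {F A : Type u} [Field F] [CommRing A] [Algebra F A]
    [Module.Finite F A] {T : A} {q : ℕ} (hT : T ^ q = 0) :
    ∃ (d : ℕ) (m : Fin d → A) (k : Fin d → ℕ), (∀ i, T ^ k i * m i = 0) ∧ (∀ i, k i ≤ q) ∧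
      (∀ x, x ∈ Submodule.span F (Set.range fun p : Fin d × ℕ => T ^ p.2 * m p.1)) ∧
      ∑ i, k i = Module.finrank F A := by
  classical
  -- With `X` acting as `T`, `A` is an `X`-power torsion module over the principal ideal domain
  -- `F[X]`, hence a direct sum of modules `F[X]/(X^(k i))`.
  let M := Module.AEval F A T
  have hX : ∀ (l : ℕ) (y : M), (Module.AEval.of F A T).symm ((Polynomial.X ^ l : Polynomial F) • y)
      = T ^ l * (Module.AEval.of F A T).symm y := by
    intro l y
    obtain ⟨z, rfl⟩ := (Module.AEval.of F A T).surjective y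
    rw [Module.AEval.X_pow_smul_of]
    simp
  have hXq : ∀ y : M, (Polynomial.X ^ q : Polynomial F) • y = 0 := by
    intro y
    apply (Module.AEval.of F A T).symm.injective
    rw [hX, hT]
    simp
  have htor : Module.IsTorsion' M (Submonoid.powers (Polynomial.X : Polynomial F)) :=
    fun y => ⟨⟨Polynomial.X ^ q, q, rfl⟩, hXq y⟩
  obtain ⟨d, k, ⟨e⟩⟩ := Module.torsion_by_prime_power_decomposition
    (R := Polynomial F) Polynomial.irreducible_X htor
  let g : Fin d → M := fun i => e.symm (DirectSum.lof (Polynomial F) (Fin d)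
    (fun i => Polynomial F ⧸ Submodule.span (Polynomial F) {(Polynomial.X : Polynomial F) ^ k i}) i
      (Submodule.Quotient.mk 1))
  refine ⟨d, fun i => (Module.AEval.of F A T).symm (g i), k, ?_, ?_, ?_, ?_⟩
  · intro i
    rw [← hX]
    have : (Polynomial.X ^ k i : Polynomial F) • g i = 0 := by
      simp only [g]
      rw [← map_smul, ← map_smul, ← Submodule.Quotient.mk_smul, smul_eq_mul, mul_one,
        (Submodule.Quotient.mk_eq_zero _).2 (Submodule.mem_span_singleton_self _)]
      simp
    rw [this, map_zero]
  · intro i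
    have h := hXq (g i)
    simp only [g] at h
    rw [← map_smul, ← map_smul, ← Submodule.Quotient.mk_smul, smul_eq_mul, mul_one,
      LinearEquiv.map_eq_zero_iff] at h
    have h2 := congrArg (fun z => z i) h
    simp only [DirectSum.lof_apply, DirectSum.zero_apply] at h2
    rw [Submodule.Quotient.mk_eq_zero] at h2
    have h3 := Ideal.mem_span_singleton.1 h2
    exact (pow_dvd_pow_iff Polynomial.X_ne_zero Polynomial.not_isUnit_X).1 h3
  · intro x
    obtain ⟨z, rfl⟩ : ∃ z, (Module.AEval.of F A T).symm (e.symm z) = x :=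
      ⟨e (Module.AEval.of F A T x), by simp⟩
    induction z using DirectSum.induction_on with
    | zero => simp
    | add y z hy hz => rw [map_add, map_add]; exact Submodule.add_mem _ hy hz
    | of i y =>
      obtain ⟨p, rfl⟩ := Submodule.Quotient.mk_surjective _ y
      induction p using Polynomial.induction_on' with
      | add p r hp hr =>
        rw [Submodule.Quotient.mk_add, map_add, map_add, map_add]
        exact Submodule.add_mem _ hp hr
      | monomial l a =>
        have : (DirectSum.of (fun i => Polynomial F ⧸ Submodule.span (Polynomial F)
            {(Polynomial.X : Polynomial F) ^ k i}) i) (Submodule.Quotient.mk (Polynomial.monomial l a))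
            = (Polynomial.C a * Polynomial.X ^ l : Polynomial F) • DirectSum.lof (Polynomial F) (Fin d)
              (fun i => Polynomial F ⧸ Submodule.span (Polynomial F)
                {(Polynomial.X : Polynomial F) ^ k i}) i (Submodule.Quotient.mk 1) := by
          rw [← map_smul, ← Submodule.Quotient.mk_smul, smul_eq_mul, mul_one,
            Polynomial.C_mul_X_pow_eq_monomial]
          rfl
        rw [this, map_smul, mul_smul, ← Polynomial.algebraMap_eq, algebraMap_smul, map_smul, hX]
        exact Submodule.smul_mem _ _ (Submodule.subset_span ⟨(i, l), rfl⟩)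
  · have e1 := (((Module.AEval.of F A T).restrictScalars F).trans (e.restrictScalars F)).finrank_eq
    have hfin : ∀ i, Module.Finite F
        (Polynomial F ⧸ Submodule.span (Polynomial F) {(Polynomial.X : Polynomial F) ^ k i}) :=
      fun i => (Polynomial.monic_X_pow (k i)).finite_quotient
    rw [e1, Module.finrank_directSum]
    refine Finset.sum_congr rfl fun i _ => ?_
    exact ((finrank_quotient_span_eq_natDegree (f := (Polynomial.X : Polynomial F) ^ k i)).trans
      (Polynomial.natDegree_X_pow _)).symm

/-- The `T^c m_i` with `c < k i` span `T^c A` modulo `T^(c+1) A`. Summed over `c`, their numbers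
give `∑ k i = dim A`, so none is redundant. -/
theorem jump_eq_card {F A : Type*} [Field F] [CommRing A] [Algebra F A] [Module.Finite F A]
    {T : A} {q : ℕ} (hT : T ^ q = 0) {d : ℕ} {m : Fin d → A} {k : Fin d → ℕ}
    (hm : ∀ i, T ^ k i * m i = 0) (hk : ∀ i, k i ≤ q)
    (hs : ∀ x, x ∈ Submodule.span F (Set.range fun p : Fin d × ℕ => T ^ p.2 * m p.1))
    (hf : ∑ i, k i = Module.finrank F A) :
    ∀ c < q, jump F T c = (Finset.univ.filter fun i => c < k i).card := by
  classical
  refine jump_eq_of_span hT _ ?_ ?_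
  · simp only [Finset.card_filter]
    rw [Finset.sum_comm, ← hf]
    refine Finset.sum_congr rfl fun i _ => ?_
    rw [← Finset.card_filter]
    have : (Finset.range q).filter (· < k i) = Finset.range (k i) := by
      ext x; have := hk i; simp; omega
    rw [this, Finset.card_range]
  · intro c hc
    refine ⟨(Finset.univ.filter fun i => c < k i).image fun i => T ^ c * m i,
      Finset.card_image_le, fun x => ?_⟩
    have hx := hs x
    induction hx using Submodule.span_induction with
    | zero => simp
    | add x y _ _ hx hy => rw [mul_add]; exact Submodule.add_mem _ hx hy
    | smul a x _ hx => rw [mul_smul_comm]; exact Submodule.smul_mem _ _ hx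
    | mem x hx =>
      obtain ⟨⟨i, l⟩, rfl⟩ := hx
      rcases l with _ | l
      · by_cases h : c < k i
        · refine Submodule.mem_sup_left (Submodule.subset_span ?_)
          simp only [Finset.coe_image, Set.mem_image, pow_zero, one_mul]
          exact ⟨i, by simpa using h, rfl⟩
        · obtain ⟨j, hj⟩ := Nat.exists_eq_add_of_le (not_lt.1 h)
          have : T ^ c * (T ^ 0 * m i) = 0 := by
            rw [hj, pow_add, pow_zero, one_mul, mul_right_comm, hm, zero_mul]
          rw [this]
          exact Submodule.zero_mem _
      · exact Submodule.mem_sup_right (mem_powRange.2 ⟨T ^ l * m i, by ring⟩)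

theorem xorCount_eq_sum {q a b c : ℕ} (ha : a ≤ q) : xorCount a b c
    = ∑ x ∈ Finset.range q, (if x < a then 1 else 0) * (if x ^^^ c < b then 1 else 0) := by
  have : (Finset.range q).filter (· < a) = Finset.range a := by
    ext x; simp; omega
  rw [xorCount, Finset.card_filter, ← this, Finset.sum_filter]
  refine Finset.sum_congr rfl fun x _ => ?_
  split_ifs <;> simp

/-- In characteristic 2 the jumps of a sum of two independent nilpotent elements are the
convolution, for addition without carries, of the jumps of the summands. -/
theorem jump_add {F A B C : Type u} [Field F] [CommRing A] [Algebra F A] [Module.Finite F A]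
    [CommRing B] [Algebra F B] [Module.Finite F B] [CommRing C] [Algebra F C] [Module.Finite F C]
    [CharP C 2] (φ : A →ₐ[F] C) (ψ : B →ₐ[F] C)
    (hspan : Submodule.span F (Set.range fun p : A × B => φ p.1 * ψ p.2) = ⊤)
    (hdim : Module.finrank F C = Module.finrank F A * Module.finrank F B)
    {n : ℕ} {g : A} {h : B} (hg : g ^ 2 ^ n = 0) (hh : h ^ 2 ^ n = 0) :
    ∀ c < 2 ^ n, jump F (φ g + ψ h) c
      = ∑ x ∈ Finset.range (2 ^ n), jump F g x * jump F h (x ^^^ c) := by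
  classical
  obtain ⟨d, m, k, hm, hk, hms, hkf⟩ := exists_jordan_generators (F := F) hg
  obtain ⟨d', m', k', hm', hk', hms', hkf'⟩ := exists_jordan_generators (F := F) hh
  have key : ∀ c < 2 ^ n, ∑ x ∈ Finset.range (2 ^ n), jump F g x * jump F h (x ^^^ c)
      = ∑ i, ∑ j, xorCount (k i) (k' j) c := by
    intro c hc
    have : ∀ x ∈ Finset.range (2 ^ n), jump F g x * jump F h (x ^^^ c)
        = ∑ i, ∑ j, (if x < k i then 1 else 0) * (if x ^^^ c < k' j then 1 else 0) := by
      intro x hx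
      rw [Finset.mem_range] at hx
      rw [jump_eq_card hg hm hk hms hkf x hx,
        jump_eq_card hh hm' hk' hms' hkf' _ (Nat.xor_lt_two_pow hx hc), Finset.card_filter,
        Finset.card_filter, Finset.sum_mul_sum]
    rw [Finset.sum_congr rfl this, Finset.sum_comm]
    refine Finset.sum_congr rfl fun i _ => ?_
    rw [Finset.sum_comm]
    exact Finset.sum_congr rfl fun j _ => (xorCount_eq_sum (hk i)).symm
  set s := φ g with hs
  set t := ψ h with ht
  have two : (2 : C) = 0 := CharP.cast_eq_zero C 2
  refine jump_eq_of_span ?_ _ ?_ ?_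
  · rw [add_pow_char_pow s t 2 n, hs, ht, ← map_pow, ← map_pow, hg, hh]
    simp
  · rw [Finset.sum_congr rfl fun c hc => key c (Finset.mem_range.1 hc), Finset.sum_comm, hdim,
      ← hkf, ← hkf', Finset.sum_mul_sum]
    refine Finset.sum_congr rfl fun i _ => ?_
    rw [Finset.sum_comm]
    exact Finset.sum_congr rfl fun j _ => sum_xorCount (hk i) (hk' j)
  · intro c hc
    rw [key c hc]
    -- For each pair of Jordan blocks, `xorCount` many powers of `s` suffice: powers of `t` are
    -- redundant modulo `T^(c+1)`, and higher powers of `s` are removed by `pow_mul_add_pow_mem`.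
    let E : Finset (Σ _ : Fin d × Fin d', ℕ) :=
      (Finset.univ : Finset (Fin d × Fin d')).sigma
        fun p => Finset.range (xorCount (k p.1) (k' p.2) c)
    refine ⟨E.image fun p => s ^ p.2 * (s + t) ^ c * (φ (m p.1.1) * ψ (m' p.1.2)), ?_, ?_⟩
    · refine Finset.card_image_le.trans ?_
      simp only [E, Finset.card_sigma, Finset.card_range]
      rw [Fintype.sum_prod_type]
    set P := Submodule.span F ((E.image fun p => s ^ p.2 * (s + t) ^ c *
      (φ (m p.1.1) * ψ (m' p.1.2)) : Finset C) : Set C) ⊔ powRange F (s + t) (c + 1) with hP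
    have hT : ∀ z, (s + t) ^ (c + 1) * z ∈ P :=
      fun z => Submodule.mem_sup_right (mem_powRange.2 ⟨z, rfl⟩)
    have gen : ∀ i j L, (s + t) ^ c * (s ^ L * (φ (m i) * ψ (m' j))) ∈ P := by
      intro i j L
      by_cases hL : L < xorCount (k i) (k' j) c
      · refine Submodule.mem_sup_left (Submodule.subset_span ?_)
        rw [Finset.coe_image]
        exact ⟨⟨(i, j), L⟩, by simpa [E] using hL, by ring⟩
      · obtain ⟨r, rfl⟩ := Nat.exists_eq_add_of_le (not_lt.1 hL)
        have hmem := pow_mul_add_pow_mem s t n (k i) (k' j) c (hk i) (hk' j) hc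
        rw [Ideal.mem_span_insert] at hmem
        obtain ⟨x, z, hz, hxz⟩ := hmem
        rw [Ideal.mem_span_pair] at hz
        obtain ⟨y, w, rfl⟩ := hz
        have h1 : s ^ k i * φ (m i) = 0 := by rw [hs, ← map_pow, ← map_mul, hm, map_zero]
        have h2 : t ^ k' j * ψ (m' j) = 0 := by rw [ht, ← map_pow, ← map_mul, hm', map_zero]
        have : (s + t) ^ c * (s ^ (xorCount (k i) (k' j) c + r) * (φ (m i) * ψ (m' j)))
            = (s + t) ^ (c + 1) * (x * s ^ r * (φ (m i) * ψ (m' j))) := by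
          rw [pow_add s]
          linear_combination (s ^ r * (φ (m i) * ψ (m' j))) * hxz
            + y * s ^ r * ψ (m' j) * h1 + w * s ^ r * φ (m i) * h2
        rw [this]
        exact hT _
    -- Since `s - t = s + t` in characteristic 2, `t^r` may be replaced by `s^r` after
    -- multiplication by `T^c`, modulo `T^(c+1)`.
    have gen2 : ∀ i j l r, (s + t) ^ c * (φ (g ^ l * m i) * ψ (h ^ r * m' j)) ∈ P := by
      intro i j l r
      obtain ⟨e, he⟩ := sub_dvd_pow_sub_pow s t r
      have : (s + t) ^ c * (φ (g ^ l * m i) * ψ (h ^ r * m' j))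
          = (s + t) ^ c * (s ^ (l + r) * (φ (m i) * ψ (m' j)))
            + (s + t) ^ (c + 1) * (s ^ l * e * (φ (m i) * ψ (m' j))) := by
        rw [map_mul, map_mul, map_pow, map_pow, ← hs, ← ht, pow_add s, pow_succ]
        linear_combination (-(s + t) ^ c * s ^ l * (φ (m i) * ψ (m' j))) * he
          - (s + t) ^ c * s ^ l * φ (m i) * ψ (m' j) * s * e * two
      rw [this]
      exact Submodule.add_mem _ (gen _ _ _) (hT _)
    have gen3 : ∀ x j r, (s + t) ^ c * (φ x * ψ (h ^ r * m' j)) ∈ P := by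
      intro x j r
      have hx := hms x
      induction hx using Submodule.span_induction with
      | zero => simp
      | add x y _ _ hx hy => rw [map_add, add_mul, mul_add]; exact Submodule.add_mem _ hx hy
      | smul a x _ hx =>
        rw [map_smul, smul_mul_assoc, mul_smul_comm]; exact Submodule.smul_mem _ _ hx
      | mem x hx =>
        obtain ⟨⟨i, l⟩, rfl⟩ := hx
        exact gen2 i j l r
    have gen4 : ∀ x y, (s + t) ^ c * (φ x * ψ y) ∈ P := by
      intro x y
      have hy := hms' y
      induction hy using Submodule.span_induction with
      | zero => simp
      | add y z _ _ hy hz => rw [map_add, mul_add, mul_add]; exact Submodule.add_mem _ hy hz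
      | smul a y _ hy =>
        rw [map_smul, mul_smul_comm, mul_smul_comm]; exact Submodule.smul_mem _ _ hy
      | mem y hy =>
        obtain ⟨⟨j, l⟩, rfl⟩ := hy
        exact gen3 x j l
    intro z
    have hz : z ∈ Submodule.span F (Set.range fun p : A × B => φ p.1 * ψ p.2) := by
      rw [hspan]; trivial
    induction hz using Submodule.span_induction with
    | zero => simp
    | add y z _ _ hy hz => rw [mul_add]; exact Submodule.add_mem _ hy hz
    | smul a y _ hy => rw [mul_smul_comm]; exact Submodule.smul_mem _ _ hy
    | mem y hy =>
      obtain ⟨⟨x, y⟩, rfl⟩ := hy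
      exact gen4 x y

/-! ### Truncated polynomial rings -/

section Box

variable (F : Type*) [Field F] (n : ℕ) (σ : Type*)

/-- The ideal generated by the `2 ^ n`-th powers of the variables. -/
def boxIdeal : Ideal (MvPolynomial σ F) :=
  Ideal.span (Set.range fun j : σ => (MvPolynomial.X j : MvPolynomial σ F) ^ 2 ^ n)

/-- The quotient of the polynomial ring by the `2 ^ n`-th powers of the variables. -/
abbrev Box : Type _ := MvPolynomial σ F ⧸ boxIdeal F n σ

variable {F n σ}

theorem mem_boxIdeal {p : MvPolynomial σ F} :
    p ∈ boxIdeal F n σ ↔ ∀ m : σ →₀ ℕ, (∀ j, m j < 2 ^ n) → p.coeff m = 0 := by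
  have : boxIdeal F n σ = Ideal.span ((fun s => MvPolynomial.monomial s (1 : F)) ''
      Set.range fun j : σ => Finsupp.single j (2 ^ n)) := by
    rw [boxIdeal, ← Set.range_comp]
    congr 2
    funext j
    simp [MvPolynomial.X_pow_eq_monomial]
  rw [this, MvPolynomial.mem_ideal_span_monomial_image]
  constructor
  · intro h m hm
    by_contra h0
    obtain ⟨_, ⟨j, rfl⟩, hj⟩ := h m (MvPolynomial.mem_support_iff.2 h0)
    have := hj j
    simp at this
    have := hm j
    omega
  · intro h m hm
    by_contra! h0
    refine MvPolynomial.mem_support_iff.1 hm (h m fun j => ?_)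
    by_contra! hj
    exact h0 _ ⟨j, rfl⟩ (Finsupp.single_le_iff.2 hj)

variable [Fintype σ]

/-- The coefficients of a polynomial at the exponents less than `2 ^ n`. -/
def boxCoeff (F : Type*) [Field F] (n : ℕ) (σ : Type*) [Fintype σ] :
    MvPolynomial σ F →ₗ[F] ((σ → Fin (2 ^ n)) → F) :=
  LinearMap.pi fun m => MvPolynomial.lcoeff F (Finsupp.equivFunOnFinite.symm fun j => (m j : ℕ))

theorem ker_boxCoeff : LinearMap.ker (boxCoeff F n σ) = (boxIdeal F n σ).restrictScalars F := by
  ext p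
  rw [LinearMap.mem_ker, Submodule.restrictScalars_mem, mem_boxIdeal]
  constructor
  · intro h m hm
    have := congrFun h fun j => ⟨m j, hm j⟩
    simpa [boxCoeff] using this
  · intro h
    funext m
    exact h _ fun j => by simp

theorem boxCoeff_surjective : Function.Surjective (boxCoeff F n σ) := by
  classical
  intro v
  refine ⟨∑ m : σ → Fin (2 ^ n), MvPolynomial.monomial
    (Finsupp.equivFunOnFinite.symm fun j => (m j : ℕ)) (v m), ?_⟩
  funext m
  simp only [boxCoeff, LinearMap.pi_apply, map_sum, MvPolynomial.lcoeff_apply,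
    MvPolynomial.coeff_monomial]
  rw [Finset.sum_eq_single m]
  · simp
  · intro m' _ hne
    rw [if_neg]
    intro h
    apply hne
    funext j
    exact Fin.ext (by simpa using DFunLike.congr_fun h j)
  · simp

/-- The monomials with exponents less than `2 ^ n` give coordinates on `Box F n σ`. -/
def boxEquiv (F : Type*) [Field F] (n : ℕ) (σ : Type*) [Fintype σ] :
    Box F n σ ≃ₗ[F] ((σ → Fin (2 ^ n)) → F) :=
  (Submodule.quotEquivOfEq ((boxIdeal F n σ).restrictScalars F) _ ker_boxCoeff.symm).trans
    ((boxCoeff F n σ).quotKerEquivOfSurjective boxCoeff_surjective)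

instance : Module.Finite F (Box F n σ) := Module.Finite.equiv (boxEquiv F n σ).symm

theorem finrank_box : Module.finrank F (Box F n σ) = (2 ^ n) ^ Fintype.card σ := by
  classical
  rw [(boxEquiv F n σ).finrank_eq, Module.finrank_fintype_fun_eq_card]
  simp

instance : Nontrivial (Box F n σ) := by
  apply Module.nontrivial_of_finrank_pos (R := F)
  rw [finrank_box]
  positivity

instance [CharP F 2] : CharP (Box F n σ) 2 :=
  charP_of_injective_algebraMap (algebraMap F (Box F n σ)).injective 2

omit [Fintype σ] in
-- By Frobenius the `2^n`-th power of `p` is the sum of the `2^n`-th powers of its terms, and every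
-- nonconstant monomial contributes an element of the ideal.
theorem mk_pow_eq_zero [CharP F 2] {p : MvPolynomial σ F}
    (hp : MvPolynomial.constantCoeff p = 0) :
    (Ideal.Quotient.mk (boxIdeal F n σ) p) ^ 2 ^ n = 0 := by
  classical
  rw [← map_pow, Ideal.Quotient.eq_zero_iff_mem, p.as_sum, sum_pow_char_pow]
  refine Ideal.sum_mem _ fun m hm => ?_
  rw [MvPolynomial.monomial_pow, mem_boxIdeal]
  intro m' hm'
  rw [MvPolynomial.coeff_monomial, if_neg]
  rintro rfl
  apply MvPolynomial.mem_support_iff.1 hm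
  have : m = 0 := by
    ext j
    have := hm' j
    simp at this
    simpa using this
  rw [this]
  exact hp

section Sum

variable {τ : Type*} [Fintype τ]

/-- The map of truncated polynomial rings given by an injection of the variables. -/
def boxRename {σ τ : Type*} (F : Type*) [Field F] (n : ℕ) (e : σ → τ) :
    Box F n σ →ₐ[F] Box F n τ :=
  Ideal.quotientMapₐ _ (MvPolynomial.rename e) (by
    rw [boxIdeal, Ideal.span_le]
    rintro _ ⟨j, rfl⟩
    simp only [Ideal.coe_comap, Set.mem_preimage, SetLike.mem_coe, map_pow,
      MvPolynomial.rename_X]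
    exact Ideal.subset_span ⟨e j, rfl⟩)

omit [Fintype σ] [Fintype τ] in
theorem boxRename_mk (e : σ → τ) (p : MvPolynomial σ F) :
    boxRename F n e (Ideal.Quotient.mk _ p) = Ideal.Quotient.mk _ (MvPolynomial.rename e p) := rfl

omit [Fintype σ] [Fintype τ] in
theorem span_boxRename_mul : Submodule.span F (Set.range fun p : Box F n σ × Box F n τ =>
    boxRename F n (Sum.inl : σ → σ ⊕ τ) p.1 * boxRename F n (Sum.inr : τ → σ ⊕ τ) p.2) = ⊤ := by
  rw [eq_top_iff]
  rintro x -
  obtain ⟨p, rfl⟩ := Ideal.Quotient.mk_surjective x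
  induction p using MvPolynomial.induction_on' with
  | add p q hp hq => rw [map_add]; exact Submodule.add_mem _ hp hq
  | monomial m a =>
    have h1 : ∃ (p : MvPolynomial σ F) (q : MvPolynomial τ F), MvPolynomial.monomial m a =
        MvPolynomial.rename Sum.inl p * MvPolynomial.rename Sum.inr q := by
      refine ⟨MvPolynomial.monomial (Finsupp.sumFinsuppEquivProdFinsupp m).1 a,
        MvPolynomial.monomial (Finsupp.sumFinsuppEquivProdFinsupp m).2 1, ?_⟩
      rw [MvPolynomial.rename_monomial, MvPolynomial.rename_monomial, MvPolynomial.monomial_mul,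
        mul_one]
      suffices h : Finsupp.mapDomain Sum.inl (Finsupp.sumFinsuppEquivProdFinsupp m).1
          + Finsupp.mapDomain Sum.inr (Finsupp.sumFinsuppEquivProdFinsupp m).2 = m by rw [h]
      refine Finsupp.ext ?_
      rintro (j | j)
      · rw [Finsupp.add_apply, Finsupp.mapDomain_apply Sum.inl_injective,
          Finsupp.mapDomain_of_notMem_range _ _ (by simp)]
        simp
      · rw [Finsupp.add_apply, Finsupp.mapDomain_apply Sum.inr_injective,
          Finsupp.mapDomain_of_notMem_range _ _ (by simp)]
        simp
    obtain ⟨p, q, h⟩ := h1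
    rw [h, map_mul, ← boxRename_mk, ← boxRename_mk]
    exact Submodule.subset_span ⟨(_, _), rfl⟩

end Sum

end Box

/-- The class of a polynomial in the truncated polynomial ring. -/
abbrev boxMk {F σ : Type*} [Field F] (n : ℕ) (p : MvPolynomial σ F) : Box F n σ :=
  Ideal.Quotient.mk (boxIdeal F n σ) p

theorem jump_rename_add {F : Type u} [Field F] [CharP F 2] {σ τ : Type} [Fintype σ] [Fintype τ]
    {n : ℕ} {p : MvPolynomial σ F} {p' : MvPolynomial τ F}
    (hp : MvPolynomial.constantCoeff p = 0) (hp' : MvPolynomial.constantCoeff p' = 0) {c : ℕ}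
    (hc : c < 2 ^ n) :
    jump F (boxMk n (MvPolynomial.rename Sum.inl p + MvPolynomial.rename Sum.inr p' :
      MvPolynomial (σ ⊕ τ) F)) c
      = ∑ x ∈ Finset.range (2 ^ n), jump F (boxMk n p) x * jump F (boxMk n p') (x ^^^ c) := by
  rw [boxMk, map_add, ← boxRename_mk, ← boxRename_mk]
  refine jump_add (boxRename F n _) (boxRename F n _) span_boxRename_mul ?_ (mk_pow_eq_zero hp)
    (mk_pow_eq_zero hp') c hc
  rw [finrank_box, finrank_box, finrank_box, Fintype.card_sum, pow_add]

theorem jump_map {F A B : Type*} [Field F] [CommRing A] [Algebra F A] [CommRing B]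
    [Algebra F B] (f : A →ₐ[F] B) (g : B →ₐ[F] A) (hgf : ∀ x, g (f x) = x)
    (hfg : ∀ y, f (g y) = y) (T : A) (c : ℕ) : jump F (f T) c = jump F T c := by
  have : ∀ c, Module.finrank F (powRange F (f T) c) = Module.finrank F (powRange F T c) := by
    intro c
    have : powRange F (f T) c = (powRange F T c).map f.toLinearMap := by
      ext y
      simp only [Submodule.mem_map, mem_powRange]
      constructor
      · rintro ⟨x, rfl⟩
        exact ⟨T ^ c * g x, ⟨_, rfl⟩, by simp [hfg]⟩
      · rintro ⟨_, ⟨x, rfl⟩, rfl⟩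
        exact ⟨f x, by simp⟩
    rw [this]
    exact (Submodule.equivMapOfInjective f.toLinearMap
      (Function.LeftInverse.injective hgf) _).finrank_eq.symm
  rw [jump, jump, this, this]

theorem boxRename_symm_apply {F : Type*} [Field F] {σ τ : Type*} (e : σ ≃ τ) (n : ℕ)
    (x : Box F n σ) : boxRename F n e.symm (boxRename F n e x) = x := by
  obtain ⟨p, rfl⟩ := Ideal.Quotient.mk_surjective x
  rw [boxRename_mk, boxRename_mk, MvPolynomial.rename_rename]
  simp

theorem jump_rename_equiv {F : Type*} [Field F] {σ τ : Type*} (e : σ ≃ τ) (n : ℕ)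
    (p : MvPolynomial σ F) (c : ℕ) :
    jump F (boxMk n (MvPolynomial.rename e p)) c = jump F (boxMk n p) c := by
  rw [boxMk, ← boxRename_mk]
  exact jump_map _ (boxRename F n e.symm) (boxRename_symm_apply e n)
    (boxRename_symm_apply e.symm n) _ c

/-! ### Passage from power series to truncated polynomials -/

section PowerSeries

variable {F : Type*} [Field F] {n r : ℕ}

/-- The ideal of power series generated by the `2 ^ n`-th powers of the variables. -/
def seriesIdeal (F : Type*) [Field F] (n r : ℕ) : Ideal (MvPowerSeries (Fin r) F) :=
  Ideal.span (Set.range fun j : Fin r => (MvPowerSeries.X j : MvPowerSeries (Fin r) F) ^ 2 ^ n)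

theorem mem_seriesIdeal {φ : MvPowerSeries (Fin r) F} :
    φ ∈ seriesIdeal F n r ↔
      ∀ m : Fin r →₀ ℕ, (∀ j, m j < 2 ^ n) → MvPowerSeries.coeff m φ = 0 := by
  classical
  constructor
  · intro h
    induction h using Submodule.span_induction with
    | zero => simp
    | add x y _ _ hx hy =>
      intro m hm
      rw [map_add, hx m hm, hy m hm, add_zero]
    | mem x hx =>
      intro m hm
      obtain ⟨j, rfl⟩ := hx
      rw [MvPowerSeries.coeff_X_pow, if_neg]
      rintro rfl
      have := hm j
      simp at this
    | smul a x _ hx =>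
      intro m hm
      rw [smul_eq_mul, MvPowerSeries.coeff_mul]
      refine Finset.sum_eq_zero fun p hp => ?_
      rw [hx p.2, mul_zero]
      intro j
      have := DFunLike.congr_fun (Finset.HasAntidiagonal.mem_antidiagonal.1 hp) j
      have := hm j
      simp at *
      omega
  -- The variables are treated one at a time: the terms with exponent of `X_j` at least `2^n` form a
  -- multiple of `X_j^(2^n)`, and the remaining series satisfies the hypothesis with one variable
  -- fewer.
  · suffices H : ∀ (S : Finset (Fin r)) (φ : MvPowerSeries (Fin r) F),
        (∀ m : Fin r →₀ ℕ, (∀ j ∈ S, m j < 2 ^ n) → MvPowerSeries.coeff m φ = 0) →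
          φ ∈ seriesIdeal F n r from
      fun h => H Finset.univ φ fun m hm => h m fun j => hm j (Finset.mem_univ j)
    intro S
    induction S using Finset.induction_on with
    | empty =>
      intro φ h
      have : φ = 0 := MvPowerSeries.ext fun m => h m (by simp)
      rw [this]
      exact Ideal.zero_mem _
    | insert j S _ ih =>
      intro φ h
      let φ₁ : MvPowerSeries (Fin r) F :=
        fun m => if m j < 2 ^ n then 0 else MvPowerSeries.coeff m φ
      let φ₂ : MvPowerSeries (Fin r) F :=
        fun m => if m j < 2 ^ n then MvPowerSeries.coeff m φ else 0
      have h₁ : ∀ m, MvPowerSeries.coeff m φ₁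
          = if m j < 2 ^ n then 0 else MvPowerSeries.coeff m φ := fun _ => rfl
      have h₂ : ∀ m, MvPowerSeries.coeff m φ₂
          = if m j < 2 ^ n then MvPowerSeries.coeff m φ else 0 := fun _ => rfl
      have hφ : φ = φ₁ + φ₂ := by
        refine MvPowerSeries.ext fun m => ?_
        rw [map_add, h₁, h₂]
        split_ifs <;> simp
      rw [hφ]
      refine Ideal.add_mem _ ?_ (ih _ fun m hm => ?_)
      · refine Ideal.mem_of_dvd _ (MvPowerSeries.X_pow_dvd_iff.2 fun m hm => ?_)
          (Ideal.subset_span ⟨j, rfl⟩)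
        rw [h₁, if_pos hm]
      · rw [h₂]
        split_ifs with hj
        · refine h m fun i hi => ?_
          rcases Finset.mem_insert.1 hi with rfl | hi
          · exact hj
          · exact hm i hi
        · rfl

theorem coe_mem_seriesIdeal {p : MvPolynomial (Fin r) F} :
    (p : MvPowerSeries (Fin r) F) ∈ seriesIdeal F n r ↔ p ∈ boxIdeal F n (Fin r) := by
  rw [mem_seriesIdeal, mem_boxIdeal]
  simp only [MvPolynomial.coeff_coe]

theorem exists_coe_sub_mem_seriesIdeal (n : ℕ) (φ : MvPowerSeries (Fin r) F) :
    ∃ p : MvPolynomial (Fin r) F, φ - p ∈ seriesIdeal F n r := by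
  classical
  refine ⟨MvPowerSeries.trunc' F (Finsupp.equivFunOnFinite.symm fun _ => 2 ^ n) φ, ?_⟩
  rw [mem_seriesIdeal]
  intro m hm
  rw [map_sub, MvPolynomial.coeff_coe, MvPowerSeries.coeff_trunc', if_pos, sub_self]
  intro j
  simpa using (hm j).le

theorem coe_sub_eq (x y : MvPolynomial (Fin r) F) :
    ((x - y : MvPolynomial (Fin r) F) : MvPowerSeries (Fin r) F) = x - y :=
  map_sub MvPolynomial.coeToMvPowerSeries.ringHom x y

/-- Every series is congruent to a polynomial modulo the `2^n`-th powers of the variables, so the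
series quotient and the quotient of the truncated ring by `p^c` are images of the polynomial ring
with the same kernel. -/
theorem hk_add_finrank (n : ℕ) (p : MvPolynomial (Fin r) F) (c : ℕ) :
    hk n ((p : MvPowerSeries (Fin r) F) ^ c) + Module.finrank F (powRange F (boxMk n p) c)
      = Module.finrank F (Box F n (Fin r)) := by
  set g : MvPowerSeries (Fin r) F := (p : MvPowerSeries (Fin r) F) ^ c with hg
  have hgc : g = ((p ^ c : MvPolynomial (Fin r) F) : MvPowerSeries (Fin r) F) := by
    rw [hg, MvPolynomial.coe_pow]
  let J : Ideal (MvPowerSeries (Fin r) F) := Ideal.span (Set.range (fun j : Fin r =>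
    (MvPowerSeries.X j : MvPowerSeries (Fin r) F) ^ 2 ^ n) ∪ {g})
  have hJ : J = seriesIdeal F n r ⊔ Ideal.span {g} := Ideal.span_union _ _
  let Θ : MvPolynomial (Fin r) F →ₗ[F] MvPowerSeries (Fin r) F ⧸ J :=
    ((Ideal.Quotient.mkₐ F J).comp (MvPolynomial.coeToMvPowerSeries.algHom F)).toLinearMap
  have hΘ : ∀ x : MvPolynomial (Fin r) F, Θ x = Ideal.Quotient.mk J (x : MvPowerSeries _ F) := by
    intro x
    simp [Θ]
  have hΘs : Function.Surjective Θ := by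
    intro y
    obtain ⟨φ, rfl⟩ := Ideal.Quotient.mk_surjective y
    obtain ⟨x, hx⟩ := exists_coe_sub_mem_seriesIdeal n φ
    refine ⟨x, ?_⟩
    rw [hΘ, eq_comm, Ideal.Quotient.mk_eq_mk_iff_sub_mem, hJ]
    exact Ideal.mem_sup_left hx
  let W := powRange F (boxMk n p) c
  let Ψ : MvPolynomial (Fin r) F →ₗ[F] Box F n (Fin r) ⧸ W :=
    W.mkQ ∘ₗ (Ideal.Quotient.mkₐ F (boxIdeal F n (Fin r))).toLinearMap
  have hΨs : Function.Surjective Ψ :=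
    (Submodule.mkQ_surjective _).comp (Ideal.Quotient.mkₐ_surjective F _)
  have hker : LinearMap.ker Θ = LinearMap.ker Ψ := by
    ext x
    have h1 : x ∈ LinearMap.ker Θ ↔ ∃ y : MvPowerSeries (Fin r) F,
        (x : MvPowerSeries (Fin r) F) - y * g ∈ seriesIdeal F n r := by
      rw [LinearMap.mem_ker, hΘ, Ideal.Quotient.eq_zero_iff_mem, hJ, Submodule.mem_sup]
      constructor
      · rintro ⟨a, ha, b, hb, hab⟩
        obtain ⟨y, rfl⟩ := Ideal.mem_span_singleton'.1 hb
        exact ⟨y, by rw [← hab, add_sub_cancel_right]; exact ha⟩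
      · rintro ⟨y, hy⟩
        exact ⟨_, hy, y * g, Ideal.mem_span_singleton'.2 ⟨y, rfl⟩, by ring⟩
    have h2 : x ∈ LinearMap.ker Ψ ↔ ∃ y : MvPolynomial (Fin r) F,
        x - y * p ^ c ∈ boxIdeal F n (Fin r) := by
      have : x ∈ LinearMap.ker Ψ ↔ boxMk n x ∈ W := by
        rw [LinearMap.mem_ker]
        exact Submodule.Quotient.mk_eq_zero W
      rw [this, mem_powRange]
      constructor
      · rintro ⟨y, hy⟩
        obtain ⟨y, rfl⟩ := Ideal.Quotient.mk_surjective y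
        refine ⟨y, ?_⟩
        rw [← Ideal.Quotient.mk_eq_mk_iff_sub_mem, map_mul, map_pow, mul_comm]
        exact hy.symm
      · rintro ⟨y, hy⟩
        refine ⟨boxMk n y, ?_⟩
        rw [← Ideal.Quotient.mk_eq_mk_iff_sub_mem, map_mul, map_pow, mul_comm] at hy
        exact hy.symm
    rw [h1, h2]
    constructor
    · rintro ⟨φ, hφ⟩
      obtain ⟨y, hy⟩ := exists_coe_sub_mem_seriesIdeal n φ
      refine ⟨y, coe_mem_seriesIdeal.1 ?_⟩
      have := Ideal.add_mem _ hφ (Ideal.mul_mem_right g _ hy)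
      rw [coe_sub_eq, MvPolynomial.coe_mul, ← hgc]
      convert this using 1
      ring
    · rintro ⟨y, hy⟩
      refine ⟨y, ?_⟩
      have := coe_mem_seriesIdeal.2 hy
      rwa [coe_sub_eq, MvPolynomial.coe_mul, ← hgc] at this
  have e : (MvPowerSeries (Fin r) F ⧸ J) ≃ₗ[F] (Box F n (Fin r) ⧸ W) :=
    (Θ.quotKerEquivOfSurjective hΘs).symm.trans
      ((Submodule.quotEquivOfEq _ _ hker).trans (Ψ.quotKerEquivOfSurjective hΨs))
  have : hk n g = Module.finrank F (Box F n (Fin r) ⧸ W) := e.finrank_eq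
  rw [this]
  exact Submodule.finrank_quotient_add_finrank W

theorem sum_jump_eq_hk (n : ℕ) (p : MvPolynomial (Fin r) F) (c : ℕ) :
    ∑ i ∈ Finset.range c, jump F (boxMk n p) i = hk n ((p : MvPowerSeries (Fin r) F) ^ c) := by
  have h1 := sum_jump_add_finrank (F := F) (boxMk n p) c
  have h2 := hk_add_finrank n p c
  omega

theorem hk_eq_jump (n : ℕ) (p : MvPolynomial (Fin r) F) :
    hk n (p : MvPowerSeries (Fin r) F) = jump F (boxMk n p) 0 := by
  have := sum_jump_eq_hk n p 1
  rwa [Finset.sum_range_one, pow_one, eq_comm] at this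

end PowerSeries

/-! ### The hypersurfaces -/

/-- The jumps of `u v` in two variables. -/
theorem jump_X_mul_X (F : Type*) [Field F] [CharP F 2] (n : ℕ) : ∀ c < 2 ^ n,
    jump F (boxMk n (MvPolynomial.X 0 * MvPolynomial.X 1 : MvPolynomial (Fin 2) F)) c
      = 2 * (2 ^ n - c) - 1 := by
  classical
  set u : Box F n (Fin 2) := boxMk n (MvPolynomial.X 0) with hu
  set v : Box F n (Fin 2) := boxMk n (MvPolynomial.X 1) with hv
  have hu0 : u ^ 2 ^ n = 0 := mk_pow_eq_zero (by simp)
  have hv0 : v ^ 2 ^ n = 0 := mk_pow_eq_zero (by simp)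
  have huv : boxMk n (MvPolynomial.X 0 * MvPolynomial.X 1 : MvPolynomial (Fin 2) F) = u * v :=
    map_mul _ _ _
  rw [huv]
  refine jump_eq_of_span (q := 2 ^ n) (by rw [mul_pow, hu0, zero_mul]) _ ?_ ?_
  · rw [finrank_box, Fintype.card_fin]
    have h : ∀ q : ℕ, ∑ c ∈ Finset.range q, (2 * (q - c) - 1) = q ^ 2 := by
      intro q
      induction q with
      | zero => simp
      | succ q ih =>
        rw [Finset.sum_range_succ']
        simp only [Nat.add_sub_add_right, ih, Nat.sub_zero]
        have : 2 * (q + 1) - 1 = 2 * q + 1 := by omega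
        rw [this]
        ring
    exact h _
  · intro c hc
    -- A monomial divisible by `uv` falls into the next power, so only pure powers of `u` or of `v`
    -- matter. The shift `b + 1` avoids counting the monomial `1` twice.
    refine ⟨(Finset.range (2 ^ n - c)).image (fun a => (u * v) ^ c * u ^ a) ∪
      (Finset.range (2 ^ n - c - 1)).image (fun b => (u * v) ^ c * v ^ (b + 1)), ?_, ?_⟩
    · refine (Finset.card_union_le _ _).trans ((Nat.add_le_add Finset.card_image_le
        Finset.card_image_le).trans ?_)
      rw [Finset.card_range, Finset.card_range]
      omega
    · intro x
      obtain ⟨p, rfl⟩ := Ideal.Quotient.mk_surjective x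
      induction p using MvPolynomial.induction_on' with
      | add p q hp hq => rw [map_add, mul_add]; exact Submodule.add_mem _ hp hq
      | monomial m a =>
        have : Ideal.Quotient.mk (boxIdeal F n (Fin 2)) (MvPolynomial.monomial m a)
            = a • (u ^ m 0 * v ^ m 1) := by
          rw [MvPolynomial.monomial_eq, Finsupp.prod_fintype _ _ (by simp), Fin.prod_univ_two,
            map_mul, map_mul, map_pow, map_pow]
          exact (Algebra.smul_def a (u ^ m 0 * v ^ m 1)).symm
        rw [this, mul_smul_comm]
        refine Submodule.smul_mem _ _ ?_
        generalize m 0 = i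
        generalize m 1 = j
        rcases Nat.eq_zero_or_pos j with rfl | hj
        · by_cases hi : i < 2 ^ n - c
          · refine Submodule.mem_sup_left (Submodule.subset_span ?_)
            simp only [Finset.coe_union, Finset.coe_image]
            exact Or.inl ⟨i, by simpa using hi, by ring⟩
          · obtain ⟨e, rfl⟩ := Nat.exists_eq_add_of_le (not_lt.1 hi)
            have : (u * v) ^ c * (u ^ (2 ^ n - c + e) * v ^ 0)
                = u ^ (c + (2 ^ n - c)) * (v ^ c * u ^ e) := by ring
            rw [this, Nat.add_sub_cancel' hc.le, hu0, zero_mul]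
            exact Submodule.zero_mem _
        · obtain ⟨j, rfl⟩ := Nat.exists_eq_succ_of_ne_zero hj.ne'
          rcases Nat.eq_zero_or_pos i with rfl | hi
          · by_cases hj : j < 2 ^ n - c - 1
            · refine Submodule.mem_sup_left (Submodule.subset_span ?_)
              simp only [Finset.coe_union, Finset.coe_image]
              exact Or.inr ⟨j, by simpa using hj, by simp⟩
            · obtain ⟨e, he⟩ := Nat.exists_eq_add_of_le
                (show 2 ^ n - c ≤ j.succ by simp at hj; omega)
              have : (u * v) ^ c * (u ^ 0 * v ^ (2 ^ n - c + e))
                  = v ^ (c + (2 ^ n - c)) * (u ^ c * v ^ e) := by ring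
              rw [he, this, Nat.add_sub_cancel' hc.le, hv0, zero_mul]
              exact Submodule.zero_mem _
          · obtain ⟨i, rfl⟩ := Nat.exists_eq_succ_of_ne_zero hi.ne'
            exact Submodule.mem_sup_right (mem_powRange.2 ⟨u ^ i * v ^ j, by
              simp only [pow_succ]; ring⟩)

/-- The nodal cubic, as a polynomial. -/
def nodalPoly (F : Type*) [Field F] : MvPolynomial (Fin 3) F :=
  MvPolynomial.X 0 ^ 3 + MvPolynomial.X 1 ^ 3
    + MvPolynomial.X 0 * MvPolynomial.X 1 * MvPolynomial.X 2

theorem coe_nodalPoly (F : Type*) [Field F] :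
    (nodalPoly F : MvPowerSeries (Fin 3) F) = nodalCubic F := by
  simp [nodalPoly, nodalCubic]

/-- `u v + u' v'`. -/
def quadric (F : Type*) [Field F] : MvPolynomial (Fin 2 ⊕ Fin 2) F :=
  MvPolynomial.rename Sum.inl (MvPolynomial.X 0 * MvPolynomial.X 1 : MvPolynomial (Fin 2) F)
    + MvPolynomial.rename Sum.inr (MvPolynomial.X 0 * MvPolynomial.X 1 : MvPolynomial (Fin 2) F)

/-- The polynomial `f(x, y, z) ^ a + f(x', y', z') ^ b + u v + u' v'`, where `f` is the nodal
cubic. -/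
def hyperPoly (F : Type*) [Field F] (a b : ℕ) :
    MvPolynomial ((Fin 3 ⊕ Fin 3) ⊕ (Fin 2 ⊕ Fin 2)) F :=
  MvPolynomial.rename Sum.inl
      (MvPolynomial.rename Sum.inl (nodalPoly F ^ a) + MvPolynomial.rename Sum.inr (nodalPoly F ^ b)
        : MvPolynomial (Fin 3 ⊕ Fin 3) F)
    + MvPolynomial.rename Sum.inr (quadric F)

theorem constantCoeff_nodalPoly (F : Type*) [Field F] {a : ℕ} (ha : a ≠ 0) :
    MvPolynomial.constantCoeff (nodalPoly F ^ a) = 0 := by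
  simp [nodalPoly, ha]

theorem constantCoeff_hyperPoly (F : Type*) [Field F] {a b : ℕ} (ha : a ≠ 0) (hb : b ≠ 0) :
    MvPolynomial.constantCoeff (hyperPoly F a b) = 0 := by
  simp only [hyperPoly, map_add, MvPolynomial.constantCoeff_rename, constantCoeff_nodalPoly F ha,
    constantCoeff_nodalPoly F hb]
  simp [quadric]

theorem hyperPoly_ne_zero (F : Type*) [Field F] {a b : ℕ} (ha : a ≠ 0) (hb : b ≠ 0) :
    hyperPoly F a b ≠ 0 := by
  intro h
  -- At `u = v = 1` with all other variables zero the polynomial takes the value `1`.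
  have := congrArg (MvPolynomial.eval (Sum.elim 0 (Sum.elim 1 0))) h
  simp [hyperPoly, quadric, nodalPoly, ha, hb] at this

/-- `hyperPoly F a b` as a power series in ten variables. -/
def hyper (F : Type*) [Field F] (a b : ℕ) : MvPowerSeries (Fin 10) F :=
  (MvPolynomial.rename (Fintype.equivFinOfCardEq (by simp) :
    ((Fin 3 ⊕ Fin 3) ⊕ (Fin 2 ⊕ Fin 2)) ≃ Fin 10) (hyperPoly F a b) : MvPolynomial (Fin 10) F)

theorem hyper_ne_zero (F : Type*) [Field F] {a b : ℕ} (ha : a ≠ 0) (hb : b ≠ 0) :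
    hyper F a b ≠ 0 := by
  rw [hyper, Ne, MvPolynomial.coe_eq_zero_iff]
  exact (map_ne_zero_iff _ (MvPolynomial.rename_injective _ (Equiv.injective _))).2
    (hyperPoly_ne_zero F ha hb)

theorem constantCoeff_hyper (F : Type*) [Field F] {a b : ℕ} (ha : a ≠ 0) (hb : b ≠ 0) :
    MvPowerSeries.constantCoeff (hyper F a b) = 0 := by
  rw [hyper, ← MvPowerSeries.coeff_zero_eq_constantCoeff_apply, MvPolynomial.coeff_coe]
  change MvPolynomial.constantCoeff _ = 0
  rw [MvPolynomial.constantCoeff_rename, constantCoeff_hyperPoly F ha hb]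

/-- Only the jump at `0` is needed, and at `0` the outer convolution pairs the cubic part and the
quadric at the same index `z`. -/
theorem hk_hyper (F : Type u) [Field F] [CharP F 2] {a b : ℕ} (ha : a ≠ 0) (hb : b ≠ 0) (n : ℕ) :
    hk n (hyper F a b) = ∑ z ∈ Finset.range (2 ^ n), (∑ x ∈ Finset.range (2 ^ n),
        jump F (boxMk n (nodalPoly F) ^ a) x * jump F (boxMk n (nodalPoly F) ^ b) (x ^^^ z))
      * ∑ w ∈ Finset.range (2 ^ n), (2 * (2 ^ n - w) - 1) * (2 * (2 ^ n - (w ^^^ z)) - 1) := by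
  have hq : (0 : ℕ) < 2 ^ n := by positivity
  rw [hyper, hk_eq_jump, jump_rename_equiv, hyperPoly,
    jump_rename_add (by rw [map_add, MvPolynomial.constantCoeff_rename, MvPolynomial.constantCoeff_rename,
        constantCoeff_nodalPoly F ha, constantCoeff_nodalPoly F hb, add_zero])
      (by simp [quadric]) hq]
  refine Finset.sum_congr rfl fun z hz => ?_
  rw [Finset.mem_range] at hz
  rw [Nat.xor_zero, jump_rename_add (constantCoeff_nodalPoly F ha) (constantCoeff_nodalPoly F hb) hz,
    quadric, jump_rename_add (by simp) (by simp) hz]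
  congr 1
  refine Finset.sum_congr rfl fun w hw => ?_
  rw [Finset.mem_range] at hw
  rw [jump_X_mul_X F n w hw, jump_X_mul_X F n _ (Nat.xor_lt_two_pow hw hz)]

/-! ### Rademacher functions -/

/-- The sign given by the `k`-th binary digit of `c`. -/
def rad (k c : ℕ) : ℚ := if c.testBit k then -1 else 1

theorem rad_xor (k c d : ℕ) : rad k (c ^^^ d) = rad k c * rad k d := by
  unfold rad
  rw [Nat.testBit_xor]
  cases c.testBit k <;> cases d.testBit k <;> simp

theorem rad_mul_self (k c : ℕ) : rad k c * rad k c = 1 := by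
  unfold rad
  split_ifs <;> norm_num

theorem rad_of_lt {k c : ℕ} (h : c < 2 ^ k) : rad k c = 1 := by
  simp [rad, Nat.testBit_lt_two_pow h]

theorem rad_two_pow_self (k : ℕ) : rad k (2 ^ k) = -1 := by
  simp [rad]

theorem rad_two_pow_of_ne {k l : ℕ} (h : k ≠ l) : rad l (2 ^ k) = 1 := by
  simp [rad, Nat.testBit_two_pow_of_ne h]

theorem rad_two_pow_add {n k c : ℕ} (hk : k < n) (hc : c < 2 ^ n) :
    rad k (2 ^ n + c) = rad k c := by
  rw [two_pow_add_eq_xor hc, rad_xor, rad_two_pow_of_ne hk.ne', one_mul]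

theorem rad_two_pow_add_self {n c : ℕ} (hc : c < 2 ^ n) : rad n (2 ^ n + c) = -1 := by
  rw [two_pow_add_eq_xor hc, rad_xor, rad_two_pow_self, rad_of_lt hc, mul_one]

/-- Flipping the digit `k` permutes the range and changes the sign of the summand. -/
theorem sum_rad {n k : ℕ} (hk : k < n) : ∑ c ∈ Finset.range (2 ^ n), rad k c = 0 := by
  have h := sum_range_xor (Nat.pow_lt_pow_right one_lt_two hk) (rad k)
  simp only [rad_xor, rad_two_pow_self, mul_neg_one, Finset.sum_neg_distrib] at h
  linarith

theorem sum_rad_mul_rad {n k l : ℕ} (hk : k < n) (hkl : k ≠ l) :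
    ∑ c ∈ Finset.range (2 ^ n), rad k c * rad l c = 0 := by
  have h := sum_range_xor (Nat.pow_lt_pow_right one_lt_two hk) (fun c => rad k c * rad l c)
  simp only [rad_xor, rad_two_pow_self, rad_two_pow_of_ne hkl, mul_neg_one, mul_one, neg_mul,
    Finset.sum_neg_distrib] at h
  linarith

/-- This is the binary expansion `w = ∑ 2^k (1 - rad k w) / 2`. It shows that products of distinct
Rademacher functions are absent from the jumps of `uv`. -/
theorem two_mul_sub_eq_sum_rad {n w : ℕ} (hw : w < 2 ^ n) :
    ((2 * (2 ^ n - w) - 1 : ℕ) : ℚ) = 2 ^ n + ∑ k ∈ Finset.range n, 2 ^ k * rad k w := by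
  have cast : ∀ {n w : ℕ}, w < 2 ^ n →
      ((2 * (2 ^ n - w) - 1 : ℕ) : ℚ) = 2 * (2 ^ n - w) - 1 := by
    intro n w hw
    rw [Nat.cast_sub (by omega), Nat.cast_mul, Nat.cast_sub hw.le]
    push_cast
    rfl
  rw [cast hw]
  clear cast
  induction n generalizing w with
  | zero =>
    obtain rfl : w = 0 := by simpa using hw
    norm_num
  | succ n ih =>
    rw [Finset.sum_range_succ]
    rcases lt_or_ge w (2 ^ n) with h | h
    · have := ih h
      rw [rad_of_lt h, pow_succ]
      linarith
    · obtain ⟨w, rfl⟩ := Nat.exists_eq_add_of_le h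
      have hw' : w < 2 ^ n := by rw [pow_succ] at hw; omega
      have := ih hw'
      rw [rad_two_pow_add_self hw', Finset.sum_congr rfl fun k hk => by
        rw [rad_two_pow_add (Finset.mem_range.1 hk) hw'], pow_succ]
      push_cast
      linarith

/-- By orthogonality of characters only equal digits interact. Using two products `uv` and `u'v'`
squares the weight `2^k` to `4^k`, which ultimately gives the value `λ = 2^(-8)`. -/
theorem sum_affine_rad_xor {n z : ℕ} :
    ∑ w ∈ Finset.range (2 ^ n), (2 ^ n + ∑ k ∈ Finset.range n, 2 ^ k * rad k w)
        * (2 ^ n + ∑ k ∈ Finset.range n, 2 ^ k * rad k (w ^^^ z))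
      = 2 ^ n * (4 ^ n + ∑ k ∈ Finset.range n, 4 ^ k * rad k z) := by
  have h0 : ∑ w ∈ Finset.range (2 ^ n), ((2 : ℚ) ^ n + ∑ k ∈ Finset.range n, 2 ^ k * rad k w)
      = 4 ^ n := by
    rw [Finset.sum_add_distrib, Finset.sum_comm, Finset.sum_eq_zero (s := Finset.range n)]
    · simp [← mul_pow]
      norm_num
    · intro k hk
      rw [← Finset.mul_sum, sum_rad (Finset.mem_range.1 hk), mul_zero]
  have h1 : ∀ l ∈ Finset.range n, ∑ w ∈ Finset.range (2 ^ n),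
      ((2 : ℚ) ^ n + ∑ k ∈ Finset.range n, 2 ^ k * rad k w) * rad l w = 2 ^ l * 2 ^ n := by
    intro l hl
    simp only [add_mul, Finset.sum_mul]
    rw [Finset.sum_add_distrib, ← Finset.mul_sum, sum_rad (Finset.mem_range.1 hl),
      Finset.sum_comm, Finset.sum_eq_single l]
    · simp only [mul_assoc, rad_mul_self]
      simp [mul_comm]
    · intro k hk hkl
      simp only [mul_assoc]
      rw [← Finset.mul_sum, sum_rad_mul_rad (Finset.mem_range.1 hk) hkl, mul_zero]
    · exact fun h => absurd hl h
  simp only [rad_xor]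
  have : ∀ w ∈ Finset.range (2 ^ n), ((2 : ℚ) ^ n + ∑ k ∈ Finset.range n, 2 ^ k * rad k w)
        * (2 ^ n + ∑ k ∈ Finset.range n, 2 ^ k * (rad k w * rad k z))
      = ((2 : ℚ) ^ n + ∑ k ∈ Finset.range n, 2 ^ k * rad k w) * 2 ^ n
        + ∑ l ∈ Finset.range n, 2 ^ l * rad l z *
          (((2 : ℚ) ^ n + ∑ k ∈ Finset.range n, 2 ^ k * rad k w) * rad l w) := by
    intro w _
    rw [mul_add, Finset.mul_sum]
    congr 1
    exact Finset.sum_congr rfl fun l _ => by ring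
  rw [Finset.sum_congr rfl this, Finset.sum_add_distrib, ← Finset.sum_mul, h0, Finset.sum_comm,
    mul_add, mul_comm, Finset.mul_sum]
  congr 1
  refine Finset.sum_congr rfl fun l hl => ?_
  rw [← Finset.mul_sum, h1 l hl]
  have : (4 : ℚ) ^ l = 2 ^ l * 2 ^ l := by rw [← mul_pow]; norm_num
  rw [this]
  ring

/-- A function multiplicative for exclusive or turns the convolution into a product; this is applied
to `1` and to each `rad k`. -/
theorem sum_xor_mul_affine_rad (n : ℕ) (a b : ℕ → ℚ) (C : ℚ) (d : ℕ → ℚ) :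
    ∑ z ∈ Finset.range (2 ^ n), (∑ x ∈ Finset.range (2 ^ n), a x * b (x ^^^ z))
        * (C + ∑ k ∈ Finset.range n, d k * rad k z)
      = C * ((∑ x ∈ Finset.range (2 ^ n), a x) * ∑ x ∈ Finset.range (2 ^ n), b x)
        + ∑ k ∈ Finset.range n, d k * ((∑ x ∈ Finset.range (2 ^ n), a x * rad k x)
          * ∑ x ∈ Finset.range (2 ^ n), b x * rad k x) := by
  have key : ∀ ρ : ℕ → ℚ, (∀ x y, ρ (x ^^^ y) = ρ x * ρ y) →
      ∑ z ∈ Finset.range (2 ^ n), (∑ x ∈ Finset.range (2 ^ n), a x * b (x ^^^ z)) * ρ z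
        = (∑ x ∈ Finset.range (2 ^ n), a x * ρ x) * ∑ x ∈ Finset.range (2 ^ n), b x * ρ x := by
    intro ρ hρ
    simp only [Finset.sum_mul]
    rw [Finset.sum_comm]
    refine Finset.sum_congr rfl fun x hx => ?_
    rw [← sum_range_xor (Finset.mem_range.1 hx), Finset.mul_sum]
    refine Finset.sum_congr rfl fun z _ => ?_
    have : x ^^^ (z ^^^ x) = z := by
      rw [Nat.xor_comm z x, ← Nat.xor_assoc, Nat.xor_self, Nat.zero_xor]
    rw [this, hρ]
    ring
  have h1 := key (fun _ => 1) (by simp)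
  simp only [mul_one] at h1
  simp only [mul_add, Finset.sum_add_distrib]
  rw [← Finset.sum_mul, h1, mul_comm _ C]
  congr 1
  rw [Finset.sum_congr rfl fun z _ => Finset.mul_sum _ _ _, Finset.sum_comm]
  refine Finset.sum_congr rfl fun k _ => ?_
  rw [← key (rad k) (rad_xor k), Finset.mul_sum]
  exact Finset.sum_congr rfl fun z _ => by ring

/-! ### The Rademacher coefficients of a function on the dyadic rationals -/

/-- The coefficient, with respect to the Rademacher function of the `m + 1`-st binary digit, of the
derivative of `α`. -/
def radCoeff (m : ℕ) (α : ℚ → ℚ) : ℚ :=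
  ∑ w ∈ Finset.range (2 ^ m),
    (2 * α ((2 * w + 1) / 2 ^ (m + 1)) - α (w / 2 ^ m) - α ((w + 1) / 2 ^ m))

theorem radCoeff_zero (α : ℚ → ℚ) : radCoeff 0 α = 2 * α (1 / 2) - α 0 - α 1 := by
  simp [radCoeff]

theorem radCoeff_succ (m : ℕ) (α : ℚ → ℚ) : radCoeff (m + 1) α
    = radCoeff m (fun t => α (t / 2)) + radCoeff m (fun t => α ((1 + t) / 2)) := by
  have h : (2 : ℚ) ^ m ≠ 0 := by positivity
  simp only [radCoeff]
  rw [pow_succ, mul_two, Finset.sum_range_add]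
  congr 1
  · refine Finset.sum_congr rfl fun w _ => ?_
    rw [div_div, div_div, div_div, ← pow_succ, ← pow_succ]
  · refine Finset.sum_congr rfl fun w _ => ?_
    have e1 : (2 * ((2 ^ m + w : ℕ) : ℚ) + 1) / 2 ^ (m + 1 + 1)
        = (1 + (2 * w + 1) / 2 ^ (m + 1)) / 2 := by
      push_cast
      rw [pow_succ, pow_succ]
      field_simp
      ring
    have e2 : ((2 ^ m + w : ℕ) : ℚ) / 2 ^ (m + 1) = (1 + w / 2 ^ m) / 2 := by
      push_cast
      rw [pow_succ]
      field_simp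
    have e3 : (((2 ^ m + w : ℕ) : ℚ) + 1) / 2 ^ (m + 1) = (1 + (w + 1) / 2 ^ m) / 2 := by
      push_cast
      rw [pow_succ]
      field_simp
      ring
    rw [e1, e2, e3]

theorem radCoeff_add (m : ℕ) (α β : ℚ → ℚ) :
    radCoeff m (fun t => α t + β t) = radCoeff m α + radCoeff m β := by
  simp only [radCoeff, ← Finset.sum_add_distrib]
  exact Finset.sum_congr rfl fun w _ => by ring

theorem radCoeff_mul (m : ℕ) (c : ℚ) (α : ℚ → ℚ) :
    radCoeff m (fun t => c * α t) = c * radCoeff m α := by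
  simp only [radCoeff, Finset.mul_sum]
  exact Finset.sum_congr rfl fun w _ => by ring

theorem radCoeff_id (m : ℕ) : radCoeff m (fun t => t) = 0 := by
  refine Finset.sum_eq_zero fun w _ => ?_
  rw [pow_succ]
  field_simp
  ring

theorem radCoeff_one_sub (m : ℕ) : radCoeff m (fun t => 1 - t) = 0 := by
  refine Finset.sum_eq_zero fun w _ => ?_
  rw [pow_succ]
  field_simp
  ring

/-- Each of the `2^m` intervals of length `2^(-m)` contributes the same second difference, `4^(-m) /
2`. -/
theorem radCoeff_mul_one_sub (m : ℕ) : radCoeff m (fun t => t * (1 - t)) = (1 / 2) ^ m / 2 := by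
  have : ∀ w ∈ Finset.range (2 ^ m), 2 * (((2 * (w : ℚ) + 1) / 2 ^ (m + 1))
      * (1 - (2 * (w : ℚ) + 1) / 2 ^ (m + 1))) - (w : ℚ) / 2 ^ m * (1 - (w : ℚ) / 2 ^ m)
        - ((w : ℚ) + 1) / 2 ^ m * (1 - ((w : ℚ) + 1) / 2 ^ m) = (1 / 2) ^ m * (1 / 2) ^ m / 2 := by
    intro w _
    rw [pow_succ, one_div, inv_pow]
    field_simp
    ring
  rw [radCoeff, Finset.sum_congr rfl this, Finset.sum_const, Finset.card_range, nsmul_eq_mul]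
  push_cast
  rw [one_div, inv_pow]
  field_simp

theorem dyadic_mem {n i : ℕ} (hi : i ≤ 2 ^ n) : (i : ℚ) / 2 ^ n ∈ I := (dyadic n i hi).2

theorem radCoeff_congr (m : ℕ) {α β : ℚ → ℚ} (h : ∀ t ∈ I, α t = β t) :
    radCoeff m α = radCoeff m β := by
  refine Finset.sum_congr rfl fun w hw => ?_
  rw [Finset.mem_range] at hw
  have h1 := h _ (dyadic_mem hw.le)
  have h2 := h _ (dyadic_mem (Nat.succ_le_of_lt hw))
  have h3 := h _ (dyadic_mem (n := m + 1) (i := 2 * w + 1) (by rw [pow_succ]; omega))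
  push_cast at h2 h3
  rw [h1, h2, h3]

/-- Bit `n - 1 - m` of `x` is the binary digit `m + 1` of `x / 2^n`. On each interval of length
`2^(-m)` the sum telescopes to the increment over the left half minus that over the right half. -/
theorem sum_sub_mul_rad (α : ℚ → ℚ) {n m : ℕ} (hm : m < n) :
    ∑ x ∈ Finset.range (2 ^ n), (α ((x + 1) / 2 ^ n) - α (x / 2 ^ n)) * rad (n - 1 - m) x
      = radCoeff m α := by
  induction n generalizing m α with
  | zero => omega
  | succ n ih =>
    have h : (2 : ℚ) ^ n ≠ 0 := by positivity
    have e1 : ∀ x : ℕ, α ((x + 1) / 2 ^ (n + 1)) - α (x / 2 ^ (n + 1))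
        = α (((x + 1) / 2 ^ n) / 2) - α ((x / 2 ^ n) / 2) := by
      intro x
      rw [pow_succ, div_div, div_div]
    have e2 : ∀ x : ℕ, α (((2 ^ n + x : ℕ) + 1) / 2 ^ (n + 1)) - α ((2 ^ n + x : ℕ) / 2 ^ (n + 1))
        = α ((1 + (x + 1) / 2 ^ n) / 2) - α ((1 + x / 2 ^ n) / 2) := by
      intro x
      push_cast
      congr 2 <;> (rw [pow_succ]; field_simp)
      ring
    rw [pow_succ, mul_two, Finset.sum_range_add]
    simp only [e2]
    rw [Finset.sum_congr rfl fun x _ => by rw [e1]]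
    rcases m with _ | m
    · have tel : ∀ β : ℚ → ℚ, ∑ x ∈ Finset.range (2 ^ n),
          (β ((x + 1) / 2 ^ n) - β (x / 2 ^ n)) = β 1 - β 0 := by
        intro β
        have := Finset.sum_range_sub (fun x : ℕ => β (x / 2 ^ n)) (2 ^ n)
        push_cast at this
        rw [this]
        simp [h]
      have t1 : ∑ x ∈ Finset.range (2 ^ n), (α (((x + 1) / 2 ^ n) / 2) - α ((x / 2 ^ n) / 2))
          * rad (n + 1 - 1 - 0) x = α (1 / 2) - α (0 / 2) := by
        rw [← tel fun t => α (t / 2)]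
        refine Finset.sum_congr rfl fun x hx => ?_
        rw [show n + 1 - 1 - 0 = n by omega, rad_of_lt (Finset.mem_range.1 hx), mul_one]
      have t2 : ∑ x ∈ Finset.range (2 ^ n), (α ((1 + (x + 1) / 2 ^ n) / 2)
          - α ((1 + x / 2 ^ n) / 2)) * rad (n + 1 - 1 - 0) (2 ^ n + x)
            = - (α ((1 + 1) / 2) - α ((1 + 0) / 2)) := by
        rw [← tel fun t => α ((1 + t) / 2), ← Finset.sum_neg_distrib]
        refine Finset.sum_congr rfl fun x hx => ?_
        rw [show n + 1 - 1 - 0 = n by omega, rad_two_pow_add_self (Finset.mem_range.1 hx),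
          mul_neg_one]
      rw [t1, t2, radCoeff_zero]
      norm_num
      ring
    · rw [radCoeff_succ, ← ih _ (show m < n by omega), ← ih _ (show m < n by omega)]
      congr 1
      · refine Finset.sum_congr rfl fun x _ => ?_
        congr 2
        omega
      · refine Finset.sum_congr rfl fun x hx => ?_
        rw [← rad_two_pow_add (show n - 1 - m < n by omega) (Finset.mem_range.1 hx)]
        congr 2
        omega

/-! ### The Rademacher coefficients of the functions `φ_k` -/

open Classical in
/-- The function `φ_k`, extended by zero to the rational numbers. -/
def phiExt (k : ℕ) (t : ℚ) : ℚ := if h : t ∈ I then phi k ⟨t, h⟩ else 0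

theorem phiExt_coe (k : ℕ) (t : I) : phiExt k t = phi k t := by
  simp [phiExt]

theorem zero_mem_I : (0 : ℚ) ∈ I := ⟨le_rfl, zero_le_one, 0, 0, by simp⟩

theorem one_mem_I : (1 : ℚ) ∈ I := ⟨zero_le_one, le_rfl, 0, 1, by simp⟩

theorem phiExt_zero (k : ℕ) : phiExt k 0 = 0 := by
  rw [phiExt, dif_pos zero_mem_I]
  exact phi_zero k _ rfl

theorem phiExt_one (k : ℕ) : phiExt k 1 = 0 := by
  rw [phiExt, dif_pos one_mem_I]
  exact phi_one k _ rfl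

theorem phiExt_left (k : ℕ) {t : ℚ} (ht : t ∈ I) : 8 * phiExt k (t / 2) =
    if Even k then phiExt (k + 1) t + (4 * k + 3) * t
      else phiExt (k - 1) t + (4 * k + 3) * t + t * (1 - t) := by
  have h := phi_left k ⟨t, ht⟩
  simp only [← phiExt_coe] at h
  exact h

theorem phiExt_right (k : ℕ) {t : ℚ} (ht : t ∈ I) : 8 * phiExt k ((1 + t) / 2) =
    if Even k then
        (if k = 0 then phiExt 0 t + 3 * (1 - t)
          else phiExt (k - 1) t + (4 * k + 3) * (1 - t) + t * (1 - t))
      else phiExt (k + 1) t + (4 * k + 3) * (1 - t) := by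
  have h := phi_right k ⟨t, ht⟩
  simp only [← phiExt_coe] at h
  exact h

theorem phiExt_half (k : ℕ) : phiExt k (1 / 2) = (4 * k + 3) / 8 := by
  have h := phiExt_left k one_mem_I
  rw [phiExt_one, phiExt_one] at h
  split_ifs at h <;> linarith

/-- The Rademacher coefficients of `φ_k`. -/
def phiCoeff (m k : ℕ) : ℚ := radCoeff m (phiExt k)

theorem phiCoeff_zero (k : ℕ) : phiCoeff 0 k = (4 * k + 3) / 4 := by
  rw [phiCoeff, radCoeff_zero, phiExt_half, phiExt_zero, phiExt_one]
  ring

theorem radCoeff_phi_add (m k : ℕ) (c : ℚ) :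
    radCoeff m (fun t => phiExt k t + c * t) = phiCoeff m k := by
  rw [radCoeff_add, radCoeff_mul, radCoeff_id, mul_zero, add_zero, phiCoeff]

theorem radCoeff_phi_add' (m k : ℕ) (c : ℚ) :
    radCoeff m (fun t => phiExt k t + c * (1 - t)) = phiCoeff m k := by
  rw [radCoeff_add, radCoeff_mul, radCoeff_one_sub, mul_zero, add_zero, phiCoeff]

theorem phiCoeff_succ_zero (m : ℕ) : 8 * phiCoeff (m + 1) 0 = phiCoeff m 1 + phiCoeff m 0 := by
  rw [phiCoeff, radCoeff_succ, mul_add, ← radCoeff_mul, ← radCoeff_mul,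
    ← radCoeff_phi_add m 1 3, ← radCoeff_phi_add' m 0 3]
  congr 1
  · refine radCoeff_congr m fun t ht => ?_
    rw [phiExt_left 0 ht, if_pos (by decide)]
    norm_num
  · refine radCoeff_congr m fun t ht => ?_
    rw [phiExt_right 0 ht, if_pos (by decide), if_pos rfl]

/-- The parity of the index only exchanges the two halves of the interval, so it disappears on
adding them. Linear terms have no Rademacher coefficients, and `t(1-t)` yields the forcing term. -/
theorem phiCoeff_succ_succ (m k : ℕ) : 8 * phiCoeff (m + 1) (k + 1)
    = phiCoeff m (k + 2) + phiCoeff m k + (1 / 2) ^ m / 2 := by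
  rw [phiCoeff, radCoeff_succ, mul_add, ← radCoeff_mul, ← radCoeff_mul, ← radCoeff_mul_one_sub]
  rcases Nat.even_or_odd (k + 1) with h | h
  · have h1 : radCoeff m (fun t => 8 * phiExt (k + 1) (t / 2)) = phiCoeff m (k + 2) := by
      rw [← radCoeff_phi_add m (k + 2) (4 * (k + 1 : ℕ) + 3)]
      refine radCoeff_congr m fun t ht => ?_
      rw [phiExt_left _ ht, if_pos h]
    have h2 : radCoeff m (fun t => 8 * phiExt (k + 1) ((1 + t) / 2))
        = phiCoeff m k + radCoeff m (fun t => t * (1 - t)) := by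
      rw [← radCoeff_phi_add' m k (4 * (k + 1 : ℕ) + 3), ← radCoeff_add]
      refine radCoeff_congr m fun t ht => ?_
      rw [phiExt_right _ ht, if_pos h, if_neg (Nat.succ_ne_zero k), Nat.add_sub_cancel]
    rw [h1, h2, add_assoc]
  · have h1 : radCoeff m (fun t => 8 * phiExt (k + 1) (t / 2))
        = phiCoeff m k + radCoeff m (fun t => t * (1 - t)) := by
      rw [← radCoeff_phi_add m k (4 * (k + 1 : ℕ) + 3), ← radCoeff_add]
      refine radCoeff_congr m fun t ht => ?_
      rw [phiExt_left _ ht, if_neg (Nat.not_even_iff_odd.2 h), Nat.add_sub_cancel]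
    have h2 : radCoeff m (fun t => 8 * phiExt (k + 1) ((1 + t) / 2)) = phiCoeff m (k + 2) := by
      rw [← radCoeff_phi_add' m (k + 2) (4 * (k + 1 : ℕ) + 3)]
      refine radCoeff_congr m fun t ht => ?_
      rw [phiExt_right _ ht, if_neg (Nat.not_even_iff_odd.2 h)]
    rw [h1, h2]
    ring

/-- Convergence requires only `k = 0`, but the recursion mixes neighbouring indices; it preserves a
bound linear in `k`. -/
theorem phiCoeff_bounds (m : ℕ) : ∀ k, 0 ≤ phiCoeff m k ∧ phiCoeff m k ≤ k + 1 := by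
  induction m with
  | zero =>
    intro k
    rw [phiCoeff_zero]
    constructor
    · positivity
    · linarith
  | succ m ih =>
    intro k
    rcases k with _ | k
    · have := phiCoeff_succ_zero m
      have := ih 0
      have := ih 1
      push_cast at *
      constructor <;> linarith
    · have h1 := phiCoeff_succ_succ m k
      have h2 := ih k
      have h3 := ih (k + 2)
      have h4 : (0 : ℚ) ≤ (1 / 2) ^ m := by positivity
      have h5 : ((1 : ℚ) / 2) ^ m ≤ 1 := pow_le_one₀ (by norm_num) (by norm_num)
      push_cast at *
      constructor <;> linarith

/-- `walks m k` counts the walks of length `m` from `k` to `0` on the natural numbers, with steps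
to the neighbours and an additional loop at `0`. -/
def walks (m k : ℕ) : ℕ := m.choose ((m + k + 1) / 2)

theorem walks_succ_succ (m k : ℕ) : walks (m + 1) (k + 1) = walks m (k + 2) + walks m k := by
  have h1 : (m + 1 + (k + 1) + 1) / 2 = (m + k + 1) / 2 + 1 := by omega
  have h2 : (m + (k + 2) + 1) / 2 = (m + k + 1) / 2 + 1 := by omega
  rw [walks, walks, walks, h1, h2, Nat.choose_succ_succ, add_comm]

theorem walks_succ_zero (m : ℕ) : walks (m + 1) 0 = walks m 1 + walks m 0 := by
  rcases Nat.even_or_odd' m with ⟨n, rfl | rfl⟩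
  · have h1 : (2 * n + 1 + 1) / 2 = n + 1 := by omega
    have h2 : (2 * n + 1) / 2 = n := by omega
    simp only [walks, add_zero, h1, h2]
    rw [Nat.choose_succ_succ', add_comm]
  · have h1 : (2 * n + 1 + 1 + 1) / 2 = n + 1 := by omega
    have h2 : (2 * n + 1 + 1) / 2 = n + 1 := by omega
    simp only [walks, add_zero, h1, h2]
    rw [Nat.choose_succ_succ' (2 * n + 1), Nat.choose_symm_half]

theorem walks_zero_zero : walks 0 0 = 1 := rfl

theorem walks_zero_succ (k : ℕ) : walks 0 (k + 1) = 0 := by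
  rw [walks, Nat.choose_eq_zero_of_lt (by omega)]

theorem walks_even (n : ℕ) : walks (2 * n) 0 = n.centralBinom := by
  rw [walks, show (2 * n + 0 + 1) / 2 = n by omega, Nat.centralBinom]

theorem two_mul_walks_odd (n : ℕ) : 2 * walks (2 * n + 1) 0 = (n + 1).centralBinom := by
  rw [walks, show (2 * n + 1 + 0 + 1) / 2 = n + 1 by omega, Nat.centralBinom,
    show 2 * (n + 1) = 2 * n + 1 + 1 by ring, Nat.choose_succ_succ' (2 * n + 1), Nat.choose_symm_half]
  ring

/-- The polynomial `64x^2 - 48x + 8 = 8(2x-1)(4x-1)` has roots `1/2` and `1/4`. The root `1/2`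
cancels the forcing term, so both sides obey the same homogeneous recursion. The starting values `k
+ 3/4` are chiefly of growth rate `1/4`, and for `m = 0` the combination vanishes once `k ≥ 2`. -/
theorem phiCoeff_combination (m : ℕ) : ∀ k,
    64 * phiCoeff (m + 2) k - 48 * phiCoeff (m + 1) k + 8 * phiCoeff m k
      = (1 / 8) ^ m * (walks (m + 1) k - 6 * walks m k) / 2 := by
  induction m with
  | zero =>
    intro k
    have z := phiCoeff_zero
    have s0 := phiCoeff_succ_zero
    have ss := phiCoeff_succ_succ
    rcases k with _ | _ | k
    · have := s0 1
      have := s0 0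
      have := ss 0 0
      simp only [z] at *
      rw [walks_succ_zero, walks_zero_zero, walks_zero_succ]
      push_cast at *
      linarith
    · have := ss 1 0
      have := ss 0 1
      have := s0 0
      have := ss 0 0
      simp only [z] at *
      rw [walks_succ_succ, walks_zero_zero, walks_zero_succ, walks_zero_succ]
      push_cast at *
      linarith
    · have := ss 1 (k + 1)
      have := ss 0 (k + 1)
      have := ss 0 (k + 2)
      have := ss 0 k
      simp only [z] at *
      rw [walks_succ_succ, walks_zero_succ, walks_zero_succ, walks_zero_succ]
      push_cast at *
      linarith
  | succ m ih =>
    intro k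
    rcases k with _ | k
    · have e1 : (walks (m + 2) 0 : ℚ) = walks (m + 1) 1 + walks (m + 1) 0 := by
        exact_mod_cast walks_succ_zero (m + 1)
      have e2 : (walks (m + 1) 0 : ℚ) = walks m 1 + walks m 0 := by
        exact_mod_cast walks_succ_zero m
      linear_combination 8 * phiCoeff_succ_zero (m + 2) - 6 * phiCoeff_succ_zero (m + 1)
        + phiCoeff_succ_zero m + (ih 0 + ih 1) / 8 - (1 / 8) ^ (m + 1) / 2 * (e1 - 6 * e2)
    · have e1 : (walks (m + 2) (k + 1) : ℚ) = walks (m + 1) (k + 2) + walks (m + 1) k := by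
        exact_mod_cast walks_succ_succ (m + 1) k
      have e2 : (walks (m + 1) (k + 1) : ℚ) = walks m (k + 2) + walks m k := by
        exact_mod_cast walks_succ_succ m k
      linear_combination 8 * phiCoeff_succ_succ (m + 2) k - 6 * phiCoeff_succ_succ (m + 1) k
        + phiCoeff_succ_succ m k + (ih k + ih (k + 2)) / 8
        - (1 / 8) ^ (m + 1) / 2 * (e1 - 6 * e2)

/-! ### The Hilbert-Kunz functions of the hypersurfaces -/

/-- The Rademacher coefficients of the function attached to `f ^ 2 ^ j`. -/
def powCoeff (j m : ℕ) : ℚ := if m < j then 1 else phiCoeff (m - j) 0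

theorem powCoeff_bounds (j m : ℕ) : 0 ≤ powCoeff j m ∧ powCoeff j m ≤ 1 := by
  rw [powCoeff]
  split_ifs
  · norm_num
  · simpa using phiCoeff_bounds (m - j) 0

theorem finrank_powRange_nodal {F : Type*} [Field F] (hconj : NodalCubicConjecture F)
    {n c : ℕ} (hc : c ≤ 2 ^ n) :
    (Module.finrank F (powRange F (boxMk n (nodalPoly F)) c) : ℚ)
      = 8 ^ n * (1 - (c / 2 ^ n + phiExt 0 (c / 2 ^ n))) := by
  have h1 := hk_add_finrank n (nodalPoly F) c
  rw [coe_nodalPoly, finrank_box, Fintype.card_fin] at h1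
  have h2 := hconj n c hc
  simp only [← phiExt_coe] at h2
  have h3 : ((dyadic n c hc : I) : ℚ) = c / 2 ^ n := rfl
  rw [h3] at h2
  have h4 : ((hk n (nodalCubic F ^ c) : ℕ) : ℚ)
      + Module.finrank F (powRange F (boxMk n (nodalPoly F)) c) = (2 ^ n) ^ 3 := by
    exact_mod_cast h1
  have h5 : ((2 : ℚ) ^ n) ^ 3 = 8 ^ n := by rw [← pow_mul, mul_comm, pow_mul]; norm_num
  rw [h5] at h2 h4
  rw [h2]
  field_simp
  linarith

/-- Powers of `f^(2^j)` are the powers of `f` with exponent divisible by `2^j`, so its jumps are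
increments of `φ_f` over steps of length `2^(-(n-j))`. -/
theorem jump_nodal_pow {F : Type*} [Field F] [CharP F 2] (hconj : NodalCubicConjecture F)
    {n j : ℕ} (hj : j ≤ n) {x : ℕ} (hx : x < 2 ^ (n - j)) :
    (jump F (boxMk n (nodalPoly F) ^ 2 ^ j) x : ℚ)
      = 8 ^ n * (((x + 1) / 2 ^ (n - j) + phiExt 0 ((x + 1) / 2 ^ (n - j)))
        - (x / 2 ^ (n - j) + phiExt 0 (x / 2 ^ (n - j)))) := by
  have hp : 2 ^ n = 2 ^ j * 2 ^ (n - j) := by rw [← pow_add, Nat.add_sub_cancel' hj]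
  have hpQ : (2 : ℚ) ^ n = 2 ^ j * 2 ^ (n - j) := by exact_mod_cast hp
  have e : ∀ y : ℕ, y ≤ 2 ^ (n - j) →
      (Module.finrank F (powRange F (boxMk n (nodalPoly F)) (2 ^ j * y)) : ℚ)
        = 8 ^ n * (1 - (y / 2 ^ (n - j) + phiExt 0 (y / 2 ^ (n - j)))) := by
    intro y hy
    rw [finrank_powRange_nodal hconj (by rw [hp]; exact Nat.mul_le_mul_left _ hy)]
    have : ((2 ^ j * y : ℕ) : ℚ) / 2 ^ n = y / 2 ^ (n - j) := by
      rw [hpQ]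
      push_cast
      exact mul_div_mul_left _ _ (by positivity)
    rw [this]
  have h := jump_add_finrank (F := F) (boxMk n (nodalPoly F) ^ 2 ^ j) x
  have hr : ∀ c, powRange F (boxMk n (nodalPoly F) ^ 2 ^ j) c
      = powRange F (boxMk n (nodalPoly F)) (2 ^ j * c) := fun c => by
    rw [powRange, powRange, pow_mul]
  rw [hr, hr] at h
  have h' : (jump F (boxMk n (nodalPoly F) ^ 2 ^ j) x : ℚ)
      + Module.finrank F (powRange F (boxMk n (nodalPoly F)) (2 ^ j * (x + 1)))
        = Module.finrank F (powRange F (boxMk n (nodalPoly F)) (2 ^ j * x)) := by exact_mod_cast h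
  rw [e x hx.le, e (x + 1) hx] at h'
  push_cast at h'
  linarith

theorem jump_nodal_pow_eq_zero {F : Type*} [Field F] [CharP F 2]
    {n j : ℕ} (hj : j ≤ n) {x : ℕ} (hx : 2 ^ (n - j) ≤ x) :
    jump F (boxMk n (nodalPoly F) ^ 2 ^ j) x = 0 := by
  have h0 : (boxMk n (nodalPoly F) ^ 2 ^ j) ^ x = 0 := by
    rw [← pow_mul]
    refine pow_eq_zero_of_le (m := 2 ^ n) ?_ ?_
    · calc 2 ^ n = 2 ^ j * 2 ^ (n - j) := by rw [← pow_add, Nat.add_sub_cancel' hj]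
        _ ≤ 2 ^ j * x := Nat.mul_le_mul_left _ hx
    · exact mk_pow_eq_zero (by simpa using constantCoeff_nodalPoly F one_ne_zero)
  rw [jump, powRange_eq_bot h0, finrank_bot, Nat.zero_sub]

theorem sum_jump_nodal_mul {F : Type*} [Field F] [CharP F 2] (hconj : NodalCubicConjecture F)
    {n j : ℕ} (hj : j ≤ n) (ρ : ℕ → ℚ) :
    ∑ x ∈ Finset.range (2 ^ n), (jump F (boxMk n (nodalPoly F) ^ 2 ^ j) x : ℚ) * ρ x
      = 8 ^ n * ∑ x ∈ Finset.range (2 ^ (n - j)),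
        (((x + 1) / 2 ^ (n - j) + phiExt 0 ((x + 1) / 2 ^ (n - j)))
          - (x / 2 ^ (n - j) + phiExt 0 (x / 2 ^ (n - j)))) * ρ x := by
  have hs : Finset.range (2 ^ (n - j)) ⊆ Finset.range (2 ^ n) :=
    Finset.range_subset_range.2 (Nat.pow_le_pow_right two_pos (Nat.sub_le n j))
  rw [← Finset.sum_subset hs, Finset.mul_sum]
  · refine Finset.sum_congr rfl fun x hx => ?_
    rw [jump_nodal_pow hconj hj (Finset.mem_range.1 hx), mul_assoc]
  · intro x _ hx
    rw [jump_nodal_pow_eq_zero hj (by simpa using hx), Nat.cast_zero, zero_mul]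

theorem sum_jump_nodal {F : Type*} [Field F] [CharP F 2] (hconj : NodalCubicConjecture F)
    {n j : ℕ} (hj : j ≤ n) :
    ∑ x ∈ Finset.range (2 ^ n), (jump F (boxMk n (nodalPoly F) ^ 2 ^ j) x : ℚ) = 8 ^ n := by
  have h := sum_jump_nodal_mul hconj hj fun _ => 1
  simp only [mul_one] at h
  have tel := Finset.sum_range_sub
    (fun x : ℕ => (x : ℚ) / 2 ^ (n - j) + phiExt 0 (x / 2 ^ (n - j))) (2 ^ (n - j))
  push_cast at tel
  rw [h, tel]
  have : (2 : ℚ) ^ (n - j) ≠ 0 := by positivity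
  simp [this, phiExt_zero, phiExt_one]

/-- The jumps of `f^(2^j)` live on `x < 2^(n-j)`, where the top `j` digits vanish. For these digits
the sign is `1` and the sum is the full dimension; each later digit is read `j` places further left.
-/
theorem sum_jump_nodal_mul_rad {F : Type*} [Field F] [CharP F 2] (hconj : NodalCubicConjecture F)
    {n j m : ℕ} (hj : j ≤ n) (hm : m < n) :
    ∑ x ∈ Finset.range (2 ^ n),
      (jump F (boxMk n (nodalPoly F) ^ 2 ^ j) x : ℚ) * rad (n - 1 - m) x = 8 ^ n * powCoeff j m := by
  rw [powCoeff]
  split_ifs with h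
  · have h1 := sum_jump_nodal_mul hconj hj fun _ => 1
    simp only [mul_one] at h1
    rw [mul_one, ← sum_jump_nodal hconj hj, sum_jump_nodal_mul hconj hj, h1]
    congr 1
    refine Finset.sum_congr rfl fun x hx => ?_
    rw [rad_of_lt ((Finset.mem_range.1 hx).trans_le
      (Nat.pow_le_pow_right two_pos (by omega))), mul_one]
  · rw [sum_jump_nodal_mul hconj hj]
    congr 1
    have h1 := sum_sub_mul_rad (fun t => t + phiExt 0 t) (n := n - j) (m := m - j) (by omega)
    rw [show n - j - 1 - (m - j) = n - 1 - m by omega] at h1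
    rw [h1, radCoeff_add, radCoeff_id, zero_add, phiCoeff]

theorem hk_hyper_div {F : Type u} [Field F] [CharP F 2] (hconj : NodalCubicConjecture F)
    {i j n : ℕ} (hi : i ≤ n) (hj : j ≤ n) :
    (hk n (hyper F (2 ^ i) (2 ^ j)) : ℚ) / (2 ^ n) ^ 9
      = 1 + ∑ m ∈ Finset.range n, (1 / 4) ^ (m + 1) * (powCoeff i m * powCoeff j m) := by
  have h2 : ∀ k : ℕ, 2 ^ k ≠ 0 := fun k => by positivity
  have h := hk_hyper F (h2 i) (h2 j) n
  have hQ : (hk n (hyper F (2 ^ i) (2 ^ j)) : ℚ) = 2 ^ n * (4 ^ n * (8 ^ n * 8 ^ n)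
      + ∑ k ∈ Finset.range n, 4 ^ (n - 1 - k) *
        (8 ^ n * powCoeff i k * (8 ^ n * powCoeff j k))) := by
    have e : ∀ z ∈ Finset.range (2 ^ n), (∑ w ∈ Finset.range (2 ^ n),
        ((2 * (2 ^ n - w) - 1 : ℕ) : ℚ) * ((2 * (2 ^ n - (w ^^^ z)) - 1 : ℕ) : ℚ))
          = 2 ^ n * (4 ^ n + ∑ k ∈ Finset.range n, 4 ^ k * rad k z) := by
      intro z hz
      rw [← sum_affine_rad_xor]
      refine Finset.sum_congr rfl fun w hw => ?_
      rw [Finset.mem_range] at hz hw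
      rw [two_mul_sub_eq_sum_rad hw, two_mul_sub_eq_sum_rad (Nat.xor_lt_two_pow hw hz)]
    rw [h]
    push_cast [-Nat.cast_sub]
    rw [Finset.sum_congr rfl fun z hz => by rw [e z hz]]
    have := sum_xor_mul_affine_rad n (fun x => jump F (boxMk n (nodalPoly F) ^ 2 ^ i) x)
      (fun x => jump F (boxMk n (nodalPoly F) ^ 2 ^ j) x) (4 ^ n) (fun k => 4 ^ k)
    rw [sum_jump_nodal hconj hi, sum_jump_nodal hconj hj,
      -- Counting digits from the top makes the coefficients independent of `n`, as the limit
      -- requires.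
      ← Finset.sum_range_reflect (fun k => (4 : ℚ) ^ k * (_ * _))] at this
    rw [Finset.sum_congr (s₁ := Finset.range n) rfl fun k hk => by
      rw [← sum_jump_nodal_mul_rad hconj hi (Finset.mem_range.1 hk),
        ← sum_jump_nodal_mul_rad hconj hj (Finset.mem_range.1 hk)], ← this, Finset.mul_sum]
    exact Finset.sum_congr rfl fun z _ => by ring
  have h8 : (8 : ℚ) ^ n = (2 ^ n) ^ 3 := by rw [← pow_mul, mul_comm, pow_mul]; norm_num
  have h4 : (4 : ℚ) ^ n = (2 ^ n) ^ 2 := by rw [← pow_mul, mul_comm, pow_mul]; norm_num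
  have hne : (2 : ℚ) ^ n ≠ 0 := by positivity
  have e2 : ∀ k ∈ Finset.range n, (4 : ℚ) ^ (n - 1 - k) * (8 ^ n * powCoeff i k *
      (8 ^ n * powCoeff j k)) = (2 ^ n) ^ 8 * ((1 / 4) ^ (k + 1) * (powCoeff i k * powCoeff j k)) := by
    intro k hk
    rw [Finset.mem_range] at hk
    have : (4 : ℚ) ^ (n - 1 - k) = 4 ^ n * (1 / 4) ^ (k + 1) := by
      have : (4 : ℚ) ^ n = 4 ^ (n - 1 - k) * 4 ^ (k + 1) := by
        rw [← pow_add]; congr 1; omega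
      rw [this, mul_assoc, ← mul_pow]
      norm_num
    rw [this, h8, h4]
    ring
  rw [hQ, Finset.sum_congr rfl e2, ← Finset.mul_sum, h8, h4]
  field_simp

/-! ### The span of the Hilbert-Kunz multiplicities -/

theorem hk_X (F : Type*) [Field F] [CharP F 2] (n : ℕ) :
    hk n (MvPowerSeries.X 0 : MvPowerSeries (Fin 1) F) = 1 := by
  classical
  rw [← MvPolynomial.coe_X, hk_eq_jump]
  have h := jump_eq_of_span (F := F) (T := boxMk n (MvPolynomial.X 0 : MvPolynomial (Fin 1) F))
    (q := 2 ^ n) (mk_pow_eq_zero (by simp)) (fun _ => 1) (by simp [finrank_box]) ?_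
  · exact h 0 (by positivity)
  intro c _
  refine ⟨{boxMk n (MvPolynomial.X 0) ^ c}, by simp, fun x => ?_⟩
  obtain ⟨p, rfl⟩ := Ideal.Quotient.mk_surjective x
  induction p using MvPolynomial.induction_on' with
  | add p q hp hq => rw [map_add, mul_add]; exact Submodule.add_mem _ hp hq
  | monomial m a =>
    have : Ideal.Quotient.mk (boxIdeal F n (Fin 1)) (MvPolynomial.monomial m a)
        = a • boxMk n (MvPolynomial.X 0) ^ m 0 := by
      rw [MvPolynomial.monomial_eq, Finsupp.prod_fintype _ _ (by simp), Fin.prod_univ_one,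
        map_mul, map_pow]
      exact (Algebra.smul_def a (boxMk n (MvPolynomial.X 0) ^ m 0)).symm
    rw [this, mul_smul_comm]
    refine Submodule.smul_mem _ _ ?_
    rcases m 0 with _ | i
    · exact Submodule.mem_sup_left (Submodule.subset_span (by simp))
    · exact Submodule.mem_sup_right (mem_powRange.2 ⟨boxMk n (MvPolynomial.X 0) ^ i, by ring⟩)

theorem one_mem_hkMultiplicities (F : Type*) [Field F] [CharP F 2] :
    (1 : ℝ) ∈ hkMultiplicities F := by
  refine ⟨1, MvPowerSeries.X 0, ?_, by simp, ?_⟩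
  · intro h
    have := congrArg (MvPowerSeries.coeff (Finsupp.single 0 1)) h
    simp [MvPowerSeries.coeff_X] at this
  · simp [IsHKMultiplicity, hk_X]

/-- The multiplicity of `X = 0` in one variable is `1`, so rational constants may be added or
dropped freely. -/
theorem ratCast_mem_span (F : Type*) [Field F] [CharP F 2] (c : ℚ) :
    (c : ℝ) ∈ Submodule.span ℚ (hkMultiplicities F) := by
  have := Submodule.smul_mem _ c (Submodule.subset_span (one_mem_hkMultiplicities F))
  rwa [Rat.smul_def, mul_one] at this

theorem hasSum_congr_eq {f g : ℕ → ℝ} {a b : ℝ} (h : HasSum f a) (hfg : ∀ n, g n = f n)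
    (hab : b = a) : HasSum g b := by
  obtain rfl : g = f := funext hfg
  rwa [hab]

/-- The weighted sum `∑ c ^ m x m` is a rational combination of Hilbert-Kunz multiplicities. -/
def HasHKSum (F : Type*) [Field F] (c : ℝ) (x : ℕ → ℝ) : Prop :=
  ∃ S ∈ Submodule.span ℚ (hkMultiplicities F), HasSum (fun m => c ^ m * x m) S

namespace HasHKSum

variable {F : Type*} [Field F] {c : ℝ} {x y : ℕ → ℝ}

theorem add (hx : HasHKSum F c x) (hy : HasHKSum F c y) : HasHKSum F c (fun m => x m + y m) := by
  obtain ⟨S, hS, hx⟩ := hx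
  obtain ⟨S', hS', hy⟩ := hy
  refine ⟨_, Submodule.add_mem _ hS hS', ?_⟩
  simp only [mul_add]
  exact hx.add hy

theorem mul_left (hx : HasHKSum F c x) (a : ℚ) : HasHKSum F c (fun m => a * x m) := by
  obtain ⟨S, hS, hx⟩ := hx
  refine ⟨_, Submodule.smul_mem _ a hS, ?_⟩
  rw [Rat.smul_def]
  exact hasSum_congr_eq (hx.mul_left (a : ℝ)) (fun m => by ring) rfl

theorem shift [CharP F 2] {c : ℚ} (hc : c ≠ 0) {x : ℕ → ℚ}
    (hx : HasHKSum F c (fun m => (x m : ℝ))) (k : ℕ) :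
    HasHKSum F c (fun m => (x (m + k) : ℝ)) := by
  obtain ⟨S, hS, hx⟩ := hx
  have h := ((hasSum_nat_add_iff' k).2 hx).mul_left (((c⁻¹) ^ k : ℚ) : ℝ)
  refine ⟨(((c⁻¹) ^ k : ℚ) : ℝ) * (S - ∑ i ∈ Finset.range k, (c : ℝ) ^ i * (x i : ℝ)), ?_,
    hasSum_congr_eq h (fun m => ?_) rfl⟩
  rotate_left
  · have : (c : ℝ) ≠ 0 := by exact_mod_cast hc
    push_cast
    rw [pow_add, inv_pow]
    field_simp
  · rw [← Rat.smul_def]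
    refine Submodule.smul_mem _ _ (Submodule.sub_mem _ hS ?_)
    convert ratCast_mem_span F (∑ i ∈ Finset.range k, c ^ i * x i) using 1
    push_cast
    rfl

end HasHKSum

theorem hasHKSum_powCoeff {F : Type u} [Field F] [CharP F 2] (hconj : NodalCubicConjecture F)
    (i j : ℕ) : HasHKSum F ((1 / 4 : ℚ) : ℝ) (fun m => ((powCoeff i m * powCoeff j m : ℚ) : ℝ)) := by
  have hs : Summable fun m : ℕ =>
      (((1 / 4 : ℚ) : ℝ) ^ m * ((powCoeff i m * powCoeff j m : ℚ) : ℝ)) := by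
    refine Summable.of_nonneg_of_le (f := fun m : ℕ => ((1 / 4 : ℚ) : ℝ) ^ m) ?_ ?_
      (summable_geometric_of_lt_one (by norm_num) (by norm_num))
    · intro m
      have := mul_nonneg (powCoeff_bounds i m).1 (powCoeff_bounds j m).1
      have : (0 : ℝ) ≤ ((powCoeff i m * powCoeff j m : ℚ) : ℝ) := by exact_mod_cast this
      positivity
    · intro m
      have := mul_le_one₀ (powCoeff_bounds i m).2 (powCoeff_bounds j m).1 (powCoeff_bounds j m).2
      have : ((powCoeff i m * powCoeff j m : ℚ) : ℝ) ≤ 1 := by exact_mod_cast this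
      exact mul_le_of_le_one_right (by positivity) this
  obtain ⟨S, hS⟩ := hs
  refine ⟨S, ?_, hS⟩
  have hmem : 1 + 1 / 4 * S ∈ hkMultiplicities F := by
    have h2 : ∀ k : ℕ, 2 ^ k ≠ 0 := fun k => by positivity
    refine ⟨10, hyper F (2 ^ i) (2 ^ j), hyper_ne_zero F (h2 i) (h2 j),
      constantCoeff_hyper F (h2 i) (h2 j), ?_⟩
    have ht := (hS.tendsto_sum_nat.const_mul (1 / 4)).const_add 1
    refine ht.congr' ?_
    filter_upwards [eventually_ge_atTop (max i j)] with n hn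
    have h := hk_hyper_div hconj ((le_max_left i j).trans hn) ((le_max_right i j).trans hn)
    have h' := congrArg (fun q : ℚ => (q : ℝ)) h
    push_cast at h' ⊢
    rw [h', Finset.mul_sum]
    congr 1
    refine Finset.sum_congr rfl fun m _ => ?_
    rw [pow_succ]
    ring
  have h4 := Submodule.smul_mem _ (4 : ℚ) (Submodule.sub_mem _ (Submodule.subset_span hmem)
    (ratCast_mem_span F 1))
  rw [Rat.smul_def] at h4
  convert h4 using 1
  push_cast
  ring

/-- The combination of the `powCoeff` that only depends on `walks`. -/
def walkCoeff (j m : ℕ) : ℚ :=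
  64 * powCoeff j m - 48 * powCoeff (j + 1) m + 8 * powCoeff (j + 2) m

/-- The index `j + 2` is the first at which all three sequences in `walkCoeff j` have left their
initial run of ones. -/
theorem walkCoeff_add (j m : ℕ) : walkCoeff j (m + (j + 2))
    = (1 / 8) ^ m * (walks (m + 1) 0 - 6 * walks m 0) / 2 := by
  rw [← phiCoeff_combination, walkCoeff, powCoeff, powCoeff, powCoeff, if_neg (by omega),
    if_neg (by omega), if_neg (by omega), show m + (j + 2) - j = m + 2 by omega,
    show m + (j + 2) - (j + 1) = m + 1 by omega, show m + (j + 2) - (j + 2) = m by omega]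

theorem hasHKSum_walkCoeff {F : Type u} [Field F] [CharP F 2] (hconj : NodalCubicConjecture F)
    (i j : ℕ) :
    HasHKSum F ((1 / 4 : ℚ) : ℝ) (fun m => ((walkCoeff i m * walkCoeff j m : ℚ) : ℝ)) := by
  have H := fun i j => hasHKSum_powCoeff hconj i j
  have key : ∀ i j, HasHKSum F ((1 / 4 : ℚ) : ℝ)
      (fun m => ((powCoeff i m * walkCoeff j m : ℚ) : ℝ)) := by
    intro i j
    convert (((H i j).mul_left 64).add ((H i (j + 1)).mul_left (-48))).add
      ((H i (j + 2)).mul_left 8) using 2 with m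
    rw [walkCoeff]
    push_cast
    ring
  convert (((key i j).mul_left 64).add ((key (i + 1) j).mul_left (-48))).add
    ((key (i + 2) j).mul_left 8) using 2 with m
  rw [walkCoeff]
  push_cast
  ring

/-- `walks (m + 1) 0 - 6 * walks m 0`. -/
def walkDiff (m : ℕ) : ℝ := walks (m + 1) 0 - 6 * walks m 0

theorem walkDiff_even (n : ℕ) :
    walkDiff (2 * n) = (n + 1).centralBinom / 2 - 6 * n.centralBinom := by
  have h : (2 * walks (2 * n + 1) 0 : ℝ) = (n + 1).centralBinom := by
    exact_mod_cast two_mul_walks_odd n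
  rw [walkDiff, walks_even, ← h]
  ring

theorem walkDiff_odd (n : ℕ) : walkDiff (2 * n + 1) = -2 * (n + 1).centralBinom := by
  have h : (2 * walks (2 * n + 1) 0 : ℝ) = (n + 1).centralBinom := by
    exact_mod_cast two_mul_walks_odd n
  rw [walkDiff, show 2 * n + 1 + 1 = 2 * (n + 1) by ring, walks_even, ← h]
  ring

theorem hasHKSum_walkDiff_sq {F : Type u} [Field F] [CharP F 2] (hconj : NodalCubicConjecture F) :
    HasHKSum F (1 / 256) (fun m => walkDiff m * walkDiff m) := by
  -- The factor `4` clears the two denominators `2`; the ratio is `256 = 4 * 8 * 8`.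
  obtain ⟨S, hS, h⟩ := ((hasHKSum_walkCoeff hconj 0 0).shift (by norm_num) (0 + 2)).mul_left 4
  refine ⟨S, hS, ?_⟩
  refine hasSum_congr_eq h (fun m => ?_) rfl
  simp only [walkCoeff_add, walkDiff]
  have : (1 / 256 : ℝ) ^ m = (1 / 4) ^ m * ((1 / 8) ^ m * (1 / 8) ^ m) := by
    rw [← mul_pow, ← mul_pow]
    norm_num
  rw [this]
  push_cast
  ring

theorem hasHKSum_walkDiff_succ {F : Type u} [Field F] [CharP F 2]
    (hconj : NodalCubicConjecture F) :
    HasHKSum F (1 / 256) (fun m => walkDiff m * walkDiff (m + 1)) := by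
  -- Delaying one factor by one place pairs `d_m` with `d_(m+1)`. The extra `8` in `32 = 2 * 2 * 8`
  -- comes from the factor of index `m + 1`.
  obtain ⟨S, hS, h⟩ := ((hasHKSum_walkCoeff hconj 1 0).shift (by norm_num) (1 + 2)).mul_left 32
  refine ⟨S, hS, ?_⟩
  refine hasSum_congr_eq h (fun m => ?_) rfl
  have h0 := walkCoeff_add 0 (m + 1)
  rw [show m + 1 + (0 + 2) = m + (1 + 2) by ring] at h0
  simp only [walkCoeff_add, h0, walkDiff, pow_succ]
  have : (1 / 256 : ℝ) ^ m = (1 / 4) ^ m * ((1 / 8) ^ m * (1 / 8) ^ m) := by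
    rw [← mul_pow, ← mul_pow]
    norm_num
  rw [this]
  push_cast
  ring

/-! ### The central binomial series and the elimination -/

theorem summable_centralBinom_sq :
    Summable fun n : ℕ => (n.centralBinom : ℝ) ^ 2 * ((1 : ℝ) / 2 ^ 8) ^ (2 * n) := by
  refine Summable.of_nonneg_of_le (f := fun n : ℕ => ((1 : ℝ) / 2 ^ 12) ^ n)
    (fun n => by positivity) ?_ (summable_geometric_of_lt_one (by norm_num) (by norm_num))
  intro n
  have h : (n.centralBinom : ℝ) ≤ 4 ^ n := by
    have : n.centralBinom ≤ 2 ^ (2 * n) := by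
      rw [Nat.centralBinom]
      exact Nat.choose_le_two_pow _ _
    rw [pow_mul] at this
    exact_mod_cast this
  calc (n.centralBinom : ℝ) ^ 2 * ((1 : ℝ) / 2 ^ 8) ^ (2 * n)
      ≤ (4 ^ n) ^ 2 * ((1 : ℝ) / 2 ^ 8) ^ (2 * n) := by gcongr
    _ = ((1 : ℝ) / 2 ^ 12) ^ n := by
      rw [← pow_mul, mul_comm n 2, pow_mul, pow_mul, ← mul_pow]
      norm_num

theorem summable_centralBinom_mul_succ : Summable fun n : ℕ =>
    (n.centralBinom : ℝ) * (n + 1).centralBinom * ((1 : ℝ) / 2 ^ 8) ^ (2 * n) := by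
  have h1 := summable_centralBinom_sq
  have h2 := ((summable_nat_add_iff 1).2 h1).mul_left ((2 : ℝ) ^ 16)
  refine Summable.of_nonneg_of_le (fun n => by positivity) ?_ (h1.add h2)
  intro n
  have h3 : (2 : ℝ) ^ 16 * (((n + 1).centralBinom : ℝ) ^ 2 * ((1 : ℝ) / 2 ^ 8) ^ (2 * (n + 1)))
      = ((n + 1).centralBinom : ℝ) ^ 2 * ((1 : ℝ) / 2 ^ 8) ^ (2 * n) := by
    rw [show 2 * (n + 1) = 2 * n + 2 by ring, pow_add]
    ring
  rw [h3, ← add_mul]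
  gcongr
  nlinarith [sq_nonneg ((n.centralBinom : ℝ) - (n + 1).centralBinom),
    sq_nonneg ((n.centralBinom : ℝ) + (n + 1).centralBinom)]

theorem tsum_mem_span {F : Type u} [Field F] [CharP F 2] (hconj : NodalCubicConjecture F) {P : ℝ}
    (hP : HasSum (fun n : ℕ => (n.centralBinom : ℝ) ^ 2 * ((1 : ℝ) / 2 ^ 8) ^ (2 * n)) P) :
    P ∈ Submodule.span ℚ (hkMultiplicities F) := by
  obtain ⟨R, hR⟩ := summable_centralBinom_mul_succ
  have hP1 : HasSum (fun n : ℕ => ((n + 1).centralBinom : ℝ) ^ 2 * ((1 : ℝ) / 2 ^ 8) ^ (2 * n))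
      (2 ^ 16 * (P - 1)) := by
    have h := ((hasSum_nat_add_iff' 1).2 hP).mul_left ((2 : ℝ) ^ 16)
    refine hasSum_congr_eq h (fun n => ?_) ?_
    · rw [show 2 * (n + 1) = 2 * n + 2 by ring, pow_add]
      ring
    · simp
  have hR1 : HasSum (fun n : ℕ => ((n + 1).centralBinom : ℝ) * (n + 2).centralBinom
      * ((1 : ℝ) / 2 ^ 8) ^ (2 * n)) (2 ^ 16 * (R - 2)) := by
    have h := ((hasSum_nat_add_iff' 1).2 hR).mul_left ((2 : ℝ) ^ 16)
    refine hasSum_congr_eq h (fun n => ?_) ?_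
    · rw [show 2 * (n + 1) = 2 * n + 2 by ring, pow_add]
      ring
    · simp [show Nat.centralBinom 1 = 2 by decide]
  obtain ⟨S₁, hS₁, h₁⟩ := hasHKSum_walkDiff_sq hconj
  obtain ⟨S₂, hS₂, h₂⟩ := hasHKSum_walkDiff_succ hconj
  -- Even and odd `m` are summed separately; shifting the index in `P` or `R` costs a factor `2^16`
  -- and the initial term.
  have e₁ : S₁ = 17444 * P - 6 * R - 17408 := by
    have he : HasSum (fun n : ℕ => (1 / 256 : ℝ) ^ (2 * n) * (walkDiff (2 * n) * walkDiff (2 * n)))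
        (1 / 4 * (2 ^ 16 * (P - 1)) + -6 * R + 36 * P) := by
      refine hasSum_congr_eq (((hP1.mul_left (1 / 4)).add (hR.mul_left (-6))).add (hP.mul_left 36)) (fun n => ?_) rfl
      rw [walkDiff_even]
      norm_num
      ring
    have ho : HasSum (fun n : ℕ => (1 / 256 : ℝ) ^ (2 * n + 1)
        * (walkDiff (2 * n + 1) * walkDiff (2 * n + 1))) (4 / 256 * (2 ^ 16 * (P - 1))) := by
      refine hasSum_congr_eq (hP1.mul_left (4 / 256)) (fun n => ?_) rfl
      rw [walkDiff_odd, pow_succ]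
      norm_num
      ring
    rw [h₁.unique (he.even_add_odd ho)]
    ring
  have e₂ : S₂ = -62464 * P - 244 * R + 62976 := by
    have he : HasSum (fun n : ℕ => (1 / 256 : ℝ) ^ (2 * n)
        * (walkDiff (2 * n) * walkDiff (2 * n + 1))) (-1 * (2 ^ 16 * (P - 1)) + 12 * R) := by
      refine hasSum_congr_eq ((hP1.mul_left (-1)).add (hR.mul_left 12)) (fun n => ?_) rfl
      rw [walkDiff_even, walkDiff_odd]
      norm_num
      ring
    have ho : HasSum (fun n : ℕ => (1 / 256 : ℝ) ^ (2 * n + 1)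
        * (walkDiff (2 * n + 1) * walkDiff (2 * n + 1 + 1)))
          (-1 / 256 * (2 ^ 16 * (R - 2)) + 12 / 256 * (2 ^ 16 * (P - 1))) := by
      refine hasSum_congr_eq ((hR1.mul_left (-1 / 256)).add (hP1.mul_left (12 / 256))) (fun n => ?_) rfl
      rw [walkDiff_odd, show 2 * n + 1 + 1 = 2 * (n + 1) by ring, walkDiff_even, pow_succ]
      norm_num
      ring
    rw [h₂.unique (he.even_add_odd ho)]
    ring
  -- Cramer's rule: the coefficients of `P` and `R` in `S₁` and `S₂` form a matrix of determinant
  -- `-4631120`.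
  have key : P = (244 / 4631120 : ℚ) • S₁ - (6 / 4631120 : ℚ) • S₂
      + ((244 * 17408 + 6 * 62976) / 4631120 : ℚ) := by
    rw [e₁, e₂, Rat.smul_def, Rat.smul_def]
    push_cast
    ring
  rw [key]
  exact Submodule.add_mem _ (Submodule.sub_mem _ (Submodule.smul_mem _ _ hS₁)
    (Submodule.smul_mem _ _ hS₂)) (ratCast_mem_span F _)

end HilbertKunz

end

theorem theorem2p2 (F : Type*) [Field F] [CharP F 2]
    (hconj : HilbertKunz.NodalCubicConjecture F) :
    ∃ S : ℝ,
      HasSum (fun n : ℕ => ((Nat.choose (2 * n) n : ℕ) : ℝ) ^ 2 * ((1 : ℝ) / 2 ^ 8) ^ (2 * n)) S ∧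
      S ∈ Submodule.span ℚ (HilbertKunz.hkMultiplicities F) := by
  obtain ⟨P, hP⟩ := HilbertKunz.summable_centralBinom_sq
  exact ⟨P, hP, HilbertKunz.tsum_mem_span hconj hP⟩
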